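/- Consider $n$ points on a circle, labelled $1,\dots,n$ in cyclic order starting from a fixed root mark on the circle. Given a set partition of these points, a crossing is a pair of crossing chords $u_1u_2$ and $v_1v_2$ such that $u_1,u_2$ belong to one block of the partition and $v_1,v_2$ belong to another block; here two chords with four distinct endpoints cross if their endpoints alternate around the circle, and every unordered pair of chords is counted once (so two blocks cross as many times as there are such pairs of chords among them). For every integer $k\ge 1$, the number $p_k(n)$ of set partitions of the $n$ points with exactly $k$ crossings satisfies \[ p_k(n) = \frac{(2k-3)!!}{2^{6k-1}\, k!\; \Gamma\!\left(k-\tfrac12\right)}\; n^{k-\frac32}\, 4^n\,(1+o(1)) \qquad (n\to\infty), \] where $(2k-3)!! = (2k-3)(2k-5)\cdots 3\cdot 1$ and $(-1)!!=1$. -/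

import Mathlib

/-- The crossings of a partition `P` of `n` points on a circle, the points being labelled
`0, 1, ..., n - 1` in the order in which they follow the root.
A chord is written as the pair of its endpoints in increasing order.  Two chords cross when their
endpoints are pairwise distinct and alternate around the circle; every unordered pair of
crossing chords is listed exactly once, the first chord being the one with the smallest endpoint.
A crossing of `P` is a pair of crossing chords, one with both endpoints in a block `U` of `P` and
the other with both endpoints in a different block `V` of `P`. -/
def partitionCrossings {n : ℕ} (P : Finpartition (Finset.univ : Finset (Fin n))) :
    Finset ((Fin n × Fin n) × (Fin n × Fin n)) :=
  Finset.univ.filter fun c =>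
    (c.1.1 < c.2.1 ∧ c.2.1 < c.1.2 ∧ c.1.2 < c.2.2) ∧
      ∃ U ∈ P.parts, ∃ V ∈ P.parts, U ≠ V ∧ c.1.1 ∈ U ∧ c.1.2 ∈ U ∧ c.2.1 ∈ V ∧ c.2.2 ∈ V

/-- The number of partitions of `n` (rooted, that is, labelled) points on a circle that have exactly
`k` crossings, counted with multiplicity. -/
def partitionCount (k n : ℕ) : ℕ :=
  (Finset.univ.filter fun P : Finpartition (Finset.univ : Finset (Fin n)) =>
    (partitionCrossings P).card = k).card

/-! Let two blocks be adjacent when some of their chords cross, and let `q` mark crossings. The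
connected component of the block of the first point occupies a set `T` of points; every other block
lies in one gap of `T`, and each gap carries an arbitrary partition. With P the series of all
partitions (`partitionSeries`) and K that of connected ones (`connectedSeries`), this says P(z) =
K(z P(z)) (`coeff_partitionSeries`), so Lagrange inversion gives (n+1) [z^n] P = [w^n] K^(n+1)
(`succ_mul_crossingPoly`).

A connected partition without crossings has at most one block, so K = 1/(1-w) + D with D
(`crossedSeries`) divisible by `q`. Its points are all ends of crossing chords, so the q^j part of D
has degree at most 4j in `w`; its q^1 part is exactly w^4. In the binomial expansion of K^(n+1),
only r ≤ k powers of D reach q^k. The r-th term carries choose(n+1, r), of order n^r, times finitely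
many binomials each of order 4^n/√n, so r = k dominates, where D^k contributes q^k w^(4k). The
remaining factor choose(2n-5k, n-k) ~ 4^n / (2^(5k) √(πn)) gives the asymptotics. -/

/-! ### Lagrange inversion for formal power series. -/

-- Coefficient of degree `d` in X (K^(n+1))' = (n+1) (X K') K^n.
open PowerSeries in
theorem PowerSeries.succ_mul_sum_coeff_mul_coeff_pow {R : Type*} [CommRing R] (K : R⟦X⟧) (n d : ℕ) :
    ((n : R) + 1) * ∑ p ∈ Finset.HasAntidiagonal.antidiagonal d, (p.1 : R) * coeff p.1 K * coeff p.2 (K ^ n) =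
      d * coeff d (K ^ (n + 1)) := by
  rcases d with _ | d
  · simp
  · have h1 : coeff d (derivative R (K ^ (n + 1))) = ((n : R) + 1) * coeff d (derivative R K * K ^ n) := by
      rw [Derivation.leibniz_pow]
      simp only [Nat.add_sub_cancel, smul_eq_mul, nsmul_eq_mul]
      rw [← map_natCast (C (R := R)), coeff_C_mul, mul_comm (K ^ n)]
      push_cast; ring
    have h2 : coeff d (derivative R (K ^ (n + 1))) = coeff (d + 1) (K ^ (n + 1)) * (d + 1) := by
      exact coeff_derivative _ _
    rw [Finset.Nat.antidiagonal_succ, Finset.sum_cons, Finset.sum_map]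
    simp only [Nat.cast_zero, zero_mul, zero_add]
    have h3 : coeff d (derivative R K * K ^ n) =
        ∑ p ∈ Finset.HasAntidiagonal.antidiagonal d, ((p.1 + 1 : ℕ) : R) * coeff (p.1 + 1) K * coeff p.2 (K ^ n) := by
      rw [coeff_mul]
      refine Finset.sum_congr rfl fun p _ => ?_
      rw [coeff_derivative]; push_cast; ring
    simp only [Function.Embedding.prodMap, Function.Embedding.coeFn_mk, Prod.map,
      Nat.succ_eq_add_one, Function.Embedding.refl_apply] at *
    rw [← h3, ← h1, h2]; push_cast; ring

open PowerSeries in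
theorem PowerSeries.coeff_X_mul_pow_eq_zero {R : Type*} [CommRing R] (A : R⟦X⟧) {n m : ℕ}
    (h : n < m) : coeff n ((X * A) ^ m) = 0 := by
  rw [mul_pow, coeff_X_pow_mul', if_neg (by omega)]

-- `hA` is the equation A = K(w) with w = X A, read coefficientwise; the sum may stop at `n` because
-- w^m is divisible by X^m. Multiplying the equation by w^m gives the claim.
open PowerSeries in
theorem PowerSeries.coeff_mul_of_fixedPoint {R : Type*} [CommRing R] {K A : R⟦X⟧}
    (hA : ∀ n, coeff n A = ∑ m ∈ Finset.range (n + 1), coeff m K * coeff n ((X * A) ^ m)) (n m : ℕ) :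
    coeff n ((X * A) ^ m * A) =
      ∑ l ∈ Finset.range (n + 1), coeff l K * coeff n ((X * A) ^ (m + l)) := by
  have h : ∀ p ∈ Finset.HasAntidiagonal.antidiagonal n, coeff p.1 ((X * A) ^ m) * coeff p.2 A =
      ∑ l ∈ Finset.range (n + 1),
        coeff p.1 ((X * A) ^ m) * (coeff l K * coeff p.2 ((X * A) ^ l)) := by
    intro p hp
    rw [← Finset.mul_sum, hA]
    congr 1
    have hp' := Finset.HasAntidiagonal.mem_antidiagonal.1 hp
    refine Finset.sum_subset (Finset.range_mono (by omega)) fun l _ hl => ?_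
    rw [coeff_X_mul_pow_eq_zero, mul_zero]
    simpa using hl
  rw [coeff_mul, Finset.sum_congr rfl h, Finset.sum_comm]
  refine Finset.sum_congr rfl fun l _ => ?_
  rw [pow_add, coeff_mul, Finset.mul_sum]
  exact Finset.sum_congr rfl fun p _ => by ring

open PowerSeries in
/-- Lagrange inversion for the powers of `w = X * A`, where `A = K(w)`. -/
theorem PowerSeries.lagrange_inversion_pow {R : Type*} [CommRing R] [IsDomain R] [CharZero R]
    {K A : R⟦X⟧}
    (hA : ∀ n, coeff n A = ∑ m ∈ Finset.range (n + 1), coeff m K * coeff n ((X * A) ^ m)) (n : ℕ) :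
    ∀ m ≤ n, (n : R) * coeff n ((X * A) ^ m) = m * coeff (n - m) (K ^ n) := by
  induction n with
  | zero => intro m hm; obtain rfl : m = 0 := by omega
            simp
  | succ n ih =>
    intro m hm
    rcases m with _ | m
    · simp [coeff_one]
    have hw : coeff (n + 1) ((X * A) ^ (m + 1)) = coeff n ((X * A) ^ m * A) := by
      rw [pow_succ, ← mul_assoc, mul_comm _ X, mul_assoc, coeff_succ_X_mul]
    -- The inductive hypothesis carries the factor `n`, so it says nothing in degree 0.
    rcases n with _ | n
    · obtain rfl : m = 0 := by omega
      rw [hw]; simp [hA 0]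
    have hmn : m ≤ n + 1 := by omega
    obtain ⟨d, hd⟩ := Nat.exists_eq_add_of_le hmn
    -- The inductive hypothesis gives w^(m+l) the weight m + l. The part `m` sums to a coefficient
    -- of K · K^(n+1); the part `l` is the weighted convolution evaluated by
    -- `succ_mul_sum_coeff_mul_coeff_pow`.
    have key : ((n + 1 : ℕ) : R) * coeff (n + 1) ((X * A) ^ m * A) =
        m * coeff d (K ^ (n + 2)) +
        ∑ p ∈ Finset.HasAntidiagonal.antidiagonal d, (p.1 : R) * coeff p.1 K * coeff p.2 (K ^ (n + 1)) := by
      rw [coeff_mul_of_fixedPoint hA, Finset.mul_sum,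
        ← Finset.sum_subset (s₁ := Finset.range (d + 1)) (Finset.range_mono (by omega)),
        pow_succ' K (n + 1), coeff_mul, Finset.mul_sum, ← Finset.sum_add_distrib,
        Finset.Nat.sum_antidiagonal_eq_sum_range_succ_mk]
      · refine Finset.sum_congr rfl fun l hl => ?_
        have hl' := Finset.mem_range.1 hl
        have := ih (m + l) (by omega)
        rw [show n + 1 - (m + l) = d - l by omega] at this
        push_cast at this ⊢
        linear_combination coeff l K * this
      · intro l _ hl
        rw [coeff_X_mul_pow_eq_zero, mul_zero, mul_zero]
        simp at hl; omega
    have h2 := succ_mul_sum_coeff_mul_coeff_pow K (n + 1) d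
    have hn : ((n : R) + 1) ≠ 0 := by exact_mod_cast n.succ_ne_zero
    rw [hw, show n + 1 + 1 - (m + 1) = d by omega]
    have hd' : (n : R) + 1 = m + d := by exact_mod_cast hd
    refine mul_left_cancel₀ hn ?_
    push_cast at key h2 ⊢
    linear_combination (n + 2 : R) * key + h2 - coeff d (K ^ (n + 2)) * hd'

open PowerSeries in
theorem PowerSeries.succ_mul_coeff_of_fixedPoint {R : Type*} [CommRing R] [IsDomain R] [CharZero R]
    {K A : R⟦X⟧}
    (hA : ∀ n, coeff n A = ∑ m ∈ Finset.range (n + 1), coeff m K * coeff n ((X * A) ^ m)) (n : ℕ) :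
    ((n : R) + 1) * coeff n A = coeff n (K ^ (n + 1)) := by
  have := lagrange_inversion_pow hA (n + 1) 1 (by omega)
  rw [pow_one, coeff_succ_X_mul] at this
  simpa using this

/-! ### Set partitions as families of blocks, and their crossing components. -/

/-- `X` is the set of blocks of a set partition of `S`. -/
structure IsPartitionOf {α : Type*} (S : Finset α) (X : Finset (Finset α)) : Prop where
  nonempty : ∀ U ∈ X, U.Nonempty
  subset : ∀ U ∈ X, U ⊆ S
  cover : ∀ x ∈ S, ∃ U ∈ X, x ∈ U
  unique : ∀ U ∈ X, ∀ V ∈ X, ∀ x, x ∈ U → x ∈ V → U = V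

/-- Some chord of `U` crosses some chord of `V`, the chord of `U` having the smallest endpoint. -/
def Crosses {α : Type*} [LinearOrder α] (U V : Finset α) : Prop :=
  ∃ a ∈ U, ∃ b ∈ V, ∃ c ∈ U, ∃ d ∈ V, a < b ∧ b < c ∧ c < d

open Classical in
/-- The crossings of a family of blocks. -/
noncomputable def crossings {α : Type*} [LinearOrder α] (X : Finset (Finset α)) :
    Finset ((α × α) × (α × α)) :=
  ((X.sup id ×ˢ X.sup id) ×ˢ (X.sup id ×ˢ X.sup id)).filter fun c =>
    (c.1.1 < c.2.1 ∧ c.2.1 < c.1.2 ∧ c.1.2 < c.2.2) ∧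
      ∃ U ∈ X, ∃ V ∈ X, U ≠ V ∧ c.1.1 ∈ U ∧ c.1.2 ∈ U ∧ c.2.1 ∈ V ∧ c.2.2 ∈ V

/-- No block of `Y` crosses a block of `Z`. -/
def NoCross {α : Type*} [LinearOrder α] (Y Z : Finset (Finset α)) : Prop :=
  ∀ U ∈ Y, ∀ V ∈ Z, ¬ Crosses U V ∧ ¬ Crosses V U

/-- The crossing graph on the blocks of `X` has at most one connected component. -/
def CrossingConnected {α : Type*} [LinearOrder α] (X : Finset (Finset α)) : Prop :=
  ∀ Y ⊆ X, Y.Nonempty → NoCross Y (X \ Y) → Y = X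

/-- Every block of `Z` lies between two consecutive points of `T`. -/
def RespectsGaps {α : Type*} [LinearOrder α] (T : Finset α) (Z : Finset (Finset α)) : Prop :=
  ∀ V ∈ Z, ∀ x ∈ V, ∀ y ∈ V, ∀ t ∈ T, x < t → ¬ t < y

section PartitionBasics

variable {α : Type*} {S T R : Finset α} {X Y Z : Finset (Finset α)}

theorem IsPartitionOf.sup_eq [DecidableEq α] (h : IsPartitionOf S X) : X.sup id = S := by
  ext x
  simp only [Finset.mem_sup, id]
  exact ⟨fun ⟨U, hU, hx⟩ => h.subset U hU hx, fun hx => h.cover x hx⟩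

theorem IsPartitionOf.of_subset [DecidableEq α] (h : IsPartitionOf S X) (hY : Y ⊆ X) :
    IsPartitionOf (Y.sup id) Y where
  nonempty U hU := h.nonempty U (hY hU)
  subset U hU := Finset.le_sup (f := id) hU
  cover x hx := by simpa [Finset.mem_sup] using hx
  unique U hU V hV := h.unique U (hY hU) V (hY hV)

theorem IsPartitionOf.union [DecidableEq α] (hY : IsPartitionOf T Y) (hZ : IsPartitionOf R Z)
    (hd : Disjoint T R) : IsPartitionOf (T ∪ R) (Y ∪ Z) where
  nonempty U hU := (Finset.mem_union.1 hU).elim (hY.nonempty U) (hZ.nonempty U)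
  subset U hU := (Finset.mem_union.1 hU).elim
    (fun h => (hY.subset U h).trans Finset.subset_union_left)
    (fun h => (hZ.subset U h).trans Finset.subset_union_right)
  cover x hx := (Finset.mem_union.1 hx).elim
    (fun h => let ⟨U, hU, hx⟩ := hY.cover x h; ⟨U, Finset.mem_union_left _ hU, hx⟩)
    (fun h => let ⟨U, hU, hx⟩ := hZ.cover x h; ⟨U, Finset.mem_union_right _ hU, hx⟩)
  unique U hU V hV x hxU hxV := by
    rcases Finset.mem_union.1 hU with hU | hU <;> rcases Finset.mem_union.1 hV with hV | hV
    · exact hY.unique U hU V hV x hxU hxV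
    · exact absurd (hZ.subset V hV hxV) (Finset.disjoint_left.1 hd (hY.subset U hU hxU))
    · exact absurd (hZ.subset U hU hxU) (Finset.disjoint_left.1 hd (hY.subset V hV hxV))
    · exact hZ.unique U hU V hV x hxU hxV

theorem IsPartitionOf.disjoint_blocks (hY : IsPartitionOf T Y) (hZ : IsPartitionOf R Z)
    (hd : Disjoint T R) : Disjoint Y Z := by
  refine Finset.disjoint_left.2 fun U hU hU' => ?_
  obtain ⟨x, hx⟩ := hY.nonempty U hU
  exact Finset.disjoint_left.1 hd (hY.subset U hU hx) (hZ.subset U hU' hx)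

theorem IsPartitionOf.sup_sdiff [DecidableEq α] (h : IsPartitionOf S X) (hY : Y ⊆ X) :
    (X \ Y).sup id = S \ Y.sup id := by
  ext x
  simp only [Finset.mem_sup, Finset.mem_sdiff, id]
  constructor
  · rintro ⟨U, ⟨hU, hUY⟩, hx⟩
    refine ⟨h.subset U hU hx, ?_⟩
    rintro ⟨V, hV, hxV⟩
    exact hUY (h.unique U hU V (hY hV) x hx hxV ▸ hV)
  · rintro ⟨hx, hn⟩
    obtain ⟨U, hU, hxU⟩ := h.cover x hx
    exact ⟨U, ⟨hU, fun hUY => hn ⟨U, hUY, hxU⟩⟩, hxU⟩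

open Classical in
/-- All set partitions of `S`. -/
noncomputable def setPartitions (S : Finset α) : Finset (Finset (Finset α)) :=
  S.powerset.powerset.filter (IsPartitionOf S)

theorem mem_setPartitions : X ∈ setPartitions S ↔ IsPartitionOf S X := by
  classical
  simp only [setPartitions, Finset.mem_filter, Finset.mem_powerset, and_iff_right_iff_imp]
  exact fun h U hU => Finset.mem_powerset.2 (h.subset U hU)

end PartitionBasics

section CrossingBasics

variable {α : Type*} [LinearOrder α] {S T R : Finset α} {X Y Z : Finset (Finset α)}

theorem mem_crossings {c : (α × α) × (α × α)} : c ∈ crossings X ↔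
    (c.1.1 < c.2.1 ∧ c.2.1 < c.1.2 ∧ c.1.2 < c.2.2) ∧
      ∃ U ∈ X, ∃ V ∈ X, U ≠ V ∧ c.1.1 ∈ U ∧ c.1.2 ∈ U ∧ c.2.1 ∈ V ∧ c.2.2 ∈ V := by
  classical
  simp only [crossings, Finset.mem_filter, Finset.mem_product, Finset.mem_sup, id,
    and_iff_right_iff_imp]
  rintro ⟨-, U, hU, V, hV, -, h1, h2, h3, h4⟩
  exact ⟨⟨⟨U, hU, h1⟩, ⟨U, hU, h2⟩⟩, ⟨V, hV, h3⟩, ⟨V, hV, h4⟩⟩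

theorem NoCross.symm (h : NoCross Y Z) : NoCross Z Y := fun U hU V hV => (h V hV U hU).symm

theorem NoCross.mono {Y' Z' : Finset (Finset α)} (h : NoCross Y Z) (hY : Y' ⊆ Y) (hZ : Z' ⊆ Z) :
    NoCross Y' Z' := fun U hU V hV => h U (hY hU) V (hZ hV)

theorem card_crossings_union (hY : IsPartitionOf T Y) (hZ : IsPartitionOf R Z)
    (hd : Disjoint T R) (hn : NoCross Y Z) :
    (crossings (Y ∪ Z)).card = (crossings Y).card + (crossings Z).card := by
  classical
  rw [← Finset.card_union_of_disjoint]
  · congr 1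
    ext ⟨⟨a, c⟩, b, d⟩
    simp only [Finset.mem_union, mem_crossings]
    constructor
    · rintro ⟨ho, U, hU, V, hV, hne, h1, h2, h3, h4⟩
      rcases hU with hU | hU <;> rcases hV with hV | hV
      · exact Or.inl ⟨ho, U, hU, V, hV, hne, h1, h2, h3, h4⟩
      · exact absurd ⟨a, h1, b, h3, c, h2, d, h4, ho⟩ (hn U hU V hV).1
      · exact absurd ⟨a, h1, b, h3, c, h2, d, h4, ho⟩ (hn V hV U hU).2
      · exact Or.inr ⟨ho, U, hU, V, hV, hne, h1, h2, h3, h4⟩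
    · rintro (⟨ho, U, hU, V, hV, h⟩ | ⟨ho, U, hU, V, hV, h⟩)
      · exact ⟨ho, U, Or.inl hU, V, Or.inl hV, h⟩
      · exact ⟨ho, U, Or.inr hU, V, Or.inr hV, h⟩
  · refine Finset.disjoint_left.2 fun c hc hc' => ?_
    obtain ⟨-, U, hU, V, hV, -, h1, -⟩ := mem_crossings.1 hc
    obtain ⟨-, U', hU', V', hV', -, h1', -⟩ := mem_crossings.1 hc'
    exact Finset.disjoint_left.1 hd (hY.subset U hU h1) (hZ.subset U' hU' h1')

/-- A crossing would put a point of `T` strictly between two points of one block of `Z`. -/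
theorem RespectsGaps.noCross (hY : IsPartitionOf T Y) (hg : RespectsGaps T Z) : NoCross Y Z := by
  intro U hU V hV
  constructor
  · rintro ⟨a, ha, b, hb, c, hc, d, hd, h1, h2, h3⟩
    exact hg V hV b hb d hd c (hY.subset U hU hc) h2 h3
  · rintro ⟨a, ha, b, hb, c, hc, d, hd, h1, h2, h3⟩
    exact hg V hV a ha c hc b (hY.subset U hU hb) h1 h2

theorem NoCross.inter_sdiff_inter {Y' : Finset (Finset α)} (h : NoCross Y (X \ Y))
    (h' : NoCross Y' (X \ Y')) : NoCross (Y ∩ Y') (X \ (Y ∩ Y')) := by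
  intro U hU V hV
  rw [Finset.mem_inter] at hU
  rw [Finset.mem_sdiff, Finset.mem_inter, not_and_or] at hV
  rcases hV.2 with hv | hv
  · exact h U hU.1 V (Finset.mem_sdiff.2 ⟨hV.1, hv⟩)
  · exact h' U hU.2 V (Finset.mem_sdiff.2 ⟨hV.1, hv⟩)

/-- Two crossing-connected closed families with a common block agree. -/
theorem CrossingConnected.eq_of_mem {Y' : Finset (Finset α)} (hc : CrossingConnected Y)
    (hc' : CrossingConnected Y') (hY : Y ⊆ X) (hY' : Y' ⊆ X) (hn : NoCross Y (X \ Y))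
    (hn' : NoCross Y' (X \ Y')) {U : Finset α} (hU : U ∈ Y) (hU' : U ∈ Y') : Y = Y' := by
  have hi := hn.inter_sdiff_inter hn'
  have hne : (Y ∩ Y').Nonempty := ⟨U, Finset.mem_inter.2 ⟨hU, hU'⟩⟩
  rw [← hc _ Finset.inter_subset_left hne
      (hi.mono subset_rfl (Finset.sdiff_subset_sdiff hY subset_rfl))]
  exact hc' _ Finset.inter_subset_right hne
      (hi.mono subset_rfl (Finset.sdiff_subset_sdiff hY' subset_rfl))

/-- Every block lies in a crossing-connected closed family of blocks. -/
theorem exists_crossingConnected {U : Finset α} (hU : U ∈ X) :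
    ∃ Y ⊆ X, U ∈ Y ∧ NoCross Y (X \ Y) ∧ CrossingConnected Y := by
  classical
  let F := X.powerset.filter fun Y => U ∈ Y ∧ NoCross Y (X \ Y)
  have hF : F.Nonempty := ⟨X, by simpa [F, hU, NoCross] using fun _ _ _ h h' => absurd h h'⟩
  -- The component of `U` is a smallest closed family containing it: if a nonempty proper subfamily
  -- `W` split off, either `W` or `Y \ W` would be a smaller one.
  obtain ⟨Y, hY, hmin⟩ := F.exists_min_image Finset.card hF
  simp only [F, Finset.mem_filter, Finset.mem_powerset] at hY hmin
  obtain ⟨hYX, hUY, hn⟩ := hY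
  refine ⟨Y, hYX, hUY, hn, fun W hW hWne hWn => ?_⟩
  have hclosed : ∀ W ⊆ Y, NoCross W (Y \ W) → NoCross W (X \ W) := by
    intro W hW hWn A hA B hB
    rw [Finset.mem_sdiff] at hB
    by_cases hBY : B ∈ Y
    · exact hWn A hA B (Finset.mem_sdiff.2 ⟨hBY, hB.2⟩)
    · exact hn A (hW hA) B (Finset.mem_sdiff.2 ⟨hB.1, hBY⟩)
  by_cases hUW : U ∈ W
  · exact Finset.eq_of_subset_of_card_le hW (hmin W ⟨hW.trans hYX, hUW, hclosed W hW hWn⟩)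
  · have h2 := hmin (Y \ W) ⟨Finset.sdiff_subset.trans hYX, Finset.mem_sdiff.2 ⟨hUY, hUW⟩,
      hclosed _ Finset.sdiff_subset (by rw [Finset.sdiff_sdiff_eq_self hW]; exact hWn.symm)⟩
    have h3 := Finset.card_sdiff_add_card_eq_card hW
    have h4 := hWne.card_pos
    omega

/-- The blocks outside the component of the smallest point lie in the gaps of that component. -/
theorem IsPartitionOf.respectsGaps_of_component (hX : IsPartitionOf S X) (hY : Y ⊆ X)
    (hn : NoCross Y (X \ Y)) (hc : CrossingConnected Y) {s : α} (hs : ∀ x ∈ S, s ≤ x)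
    (hsY : s ∈ Y.sup id) : RespectsGaps (Y.sup id) (X \ Y) := by
  classical
  intro V hV x hx y hy t ht hxt hty
  simp only [Finset.mem_sup, id] at ht hsY
  obtain ⟨A, hA, hsA⟩ := hsY
  obtain ⟨B, hB, htB⟩ := ht
  have hVX := (Finset.mem_sdiff.1 hV).1
  have hsV : s ∉ V := fun h =>
    (Finset.mem_sdiff.1 hV).2 (hX.unique V hVX A (hY hA) s h hsA ▸ hA)
  have hsx : s < x := lt_of_le_of_ne (hs x (hX.subset V hVX hx)) fun h => hsV (h ▸ hx)
  have hne : ∀ U ∈ Y, ∀ u ∈ U, ∀ v ∈ V, u ≠ v := fun U hU u hu v hv h =>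
    (Finset.mem_sdiff.1 hV).2 (hX.unique V hVX U (hY hU) u (h ▸ hv) hu ▸ hU)
  -- A block with points inside and outside the interval from `x` to `y` would cross `V`.
  have side : ∀ U ∈ Y, ∀ u ∈ U, x < u → u < y → ∀ w ∈ U, x < w ∧ w < y := by
    intro U hU u hu h1 h2 w hw
    by_contra hcon
    rw [not_and_or, not_lt, not_lt] at hcon
    rcases hcon with h | h
    · exact (hn U hU V hV).1 ⟨w, hw, x, hx, u, hu, y, hy,
        lt_of_le_of_ne h (hne U hU w hw x hx), h1, h2⟩
    · exact (hn U hU V hV).2 ⟨x, hx, u, hu, y, hy, w, hw, h1, h2,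
        lt_of_le_of_ne h (hne U hU w hw y hy).symm⟩
  -- The blocks inside the interval cross none of the others in `Y`. They include `B` but not the
  -- block `A` of the smallest point, which contradicts connectedness.
  let W := Y.filter fun U => ∀ w ∈ U, x < w ∧ w < y
  have hWY : W ⊆ Y := Finset.filter_subset _ _
  have hBW : B ∈ W := Finset.mem_filter.2 ⟨hB, side B hB t htB hxt hty⟩
  have hWn : NoCross W (Y \ W) := by
    intro U hU U' hU'
    obtain ⟨hUY, hUin⟩ := Finset.mem_filter.1 hU
    obtain ⟨hUY', hUW'⟩ := Finset.mem_sdiff.1 hU'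
    have hout : ∀ w ∈ U', x < w → w < y → False := fun w hw h1 h2 =>
      hUW' (Finset.mem_filter.2 ⟨hUY', side U' hUY' w hw h1 h2⟩)
    constructor
    · rintro ⟨a, ha, b, hb, c, hc, d, hd, h1, h2, h3⟩
      exact hout b hb ((hUin a ha).1.trans h1) (h2.trans (hUin c hc).2)
    · rintro ⟨a, ha, b, hb, c, hc, d, hd, h1, h2, h3⟩
      exact hout c hc ((hUin b hb).1.trans h2) (h3.trans (hUin d hd).2)
  have hWe := hc W hWY ⟨B, hBW⟩ hWn
  rw [← hWe] at hA
  exact absurd ((Finset.mem_filter.1 hA).2 s hsA).1 hsx.not_gt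

end CrossingBasics

/-! ### Decomposition of a partition along the component of its first point. -/

section CrossingPolynomials

open Polynomial

variable {α : Type*} [LinearOrder α]

/-- The generating polynomial of the set partitions of `S` by number of crossings. -/
noncomputable def crossingPoly (S : Finset α) : ℝ[X] :=
  ∑ P ∈ setPartitions S, X ^ (crossings P).card

open Classical in
/-- The crossing-connected set partitions of `S`. -/
noncomputable def connectedPartitions (S : Finset α) : Finset (Finset (Finset α)) :=
  (setPartitions S).filter CrossingConnected

/-- The generating polynomial of the connected set partitions of `S` by number of crossings. -/
noncomputable def connectedPoly (S : Finset α) : ℝ[X] :=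
  ∑ P ∈ connectedPartitions S, X ^ (crossings P).card

open Classical in
/-- The set partitions of `R` whose blocks lie in the gaps of `T`. -/
noncomputable def gapPartitions (T R : Finset α) : Finset (Finset (Finset α)) :=
  (setPartitions R).filter (RespectsGaps T)

/-- The generating polynomial of the set partitions of `R` whose blocks lie in the gaps of `T`. -/
noncomputable def gapPoly (T R : Finset α) : ℝ[X] :=
  ∑ P ∈ gapPartitions T R, X ^ (crossings P).card

theorem mem_connectedPartitions {S : Finset α} {P : Finset (Finset α)} :
    P ∈ connectedPartitions S ↔ IsPartitionOf S P ∧ CrossingConnected P := by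
  classical
  simp [connectedPartitions, mem_setPartitions]

theorem mem_gapPartitions {T R : Finset α} {P : Finset (Finset α)} :
    P ∈ gapPartitions T R ↔ IsPartitionOf R P ∧ RespectsGaps T P := by
  classical
  simp [gapPartitions, mem_setPartitions]

/-- A partition corresponds to the component `Y` of the block of `s`, with point set `T`, together
with the remaining blocks, which lie in the gaps of `T`. No crossing is mixed, so crossing numbers
add. -/
theorem crossingPoly_eq_sum {S : Finset α} {s : α} (hsS : s ∈ S) (hs : ∀ x ∈ S, s ≤ x) :
    crossingPoly S =
      ∑ T ∈ S.powerset.filter (s ∈ ·), connectedPoly T * gapPoly T (S \ T) := by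
  classical
  simp only [connectedPoly, gapPoly, Finset.sum_mul_sum]
  simp only [← Finset.sum_product', ← pow_add]
  rw [Finset.sum_sigma', crossingPoly]
  symm
  refine Finset.sum_bij (fun p _ => p.2.1 ∪ p.2.2) ?_ ?_ ?_ ?_
  · rintro ⟨T, Y, Z⟩ h
    simp only [Finset.mem_sigma, Finset.mem_filter, Finset.mem_powerset, Finset.mem_product,
      mem_connectedPartitions, mem_gapPartitions] at h
    obtain ⟨⟨hT, -⟩, ⟨hY, -⟩, hZ, -⟩ := h
    rw [mem_setPartitions]
    simpa [Finset.union_sdiff_of_subset hT] using hY.union hZ Finset.disjoint_sdiff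
  · rintro ⟨T, Y, Z⟩ h ⟨T', Y', Z'⟩ h' he
    simp only [Finset.mem_sigma, Finset.mem_filter, Finset.mem_powerset, Finset.mem_product,
      mem_connectedPartitions, mem_gapPartitions] at h h' he
    obtain ⟨⟨hT, hsT⟩, ⟨hY, hYc⟩, hZ, hZg⟩ := h
    obtain ⟨⟨hT', hsT'⟩, ⟨hY', hYc'⟩, hZ', hZg'⟩ := h'
    have hd := hY.disjoint_blocks hZ Finset.disjoint_sdiff
    have hd' := hY'.disjoint_blocks hZ' Finset.disjoint_sdiff
    have e1 : (Y ∪ Z) \ Y = Z := Finset.union_sdiff_cancel_left hd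
    have e2 : (Y ∪ Z) \ Y' = Z' := by rw [he]; exact Finset.union_sdiff_cancel_left hd'
    have hX := hY.union hZ Finset.disjoint_sdiff
    obtain ⟨U, hU, hsU⟩ := hY.cover s hsT
    obtain ⟨U', hU', hsU'⟩ := hY'.cover s hsT'
    have hYs : Y ⊆ Y ∪ Z := Finset.subset_union_left
    have hYs' : Y' ⊆ Y ∪ Z := he ▸ Finset.subset_union_left
    have hUU : U = U' := hX.unique U (hYs hU) U' (hYs' hU') s hsU hsU'
    -- Both families are the component of the block containing `s`.
    have hYY : Y = Y' := hYc.eq_of_mem hYc' hYs hYs' (by rw [e1]; exact hZg.noCross hY)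
      (by rw [e2]; exact hZg'.noCross hY') hU (hUU ▸ hU')
    subst hYY
    obtain rfl : Z = Z' := e1.symm.trans e2
    obtain rfl : T = T' := hY.sup_eq.symm.trans hY'.sup_eq
    rfl
  · intro P hP
    rw [mem_setPartitions] at hP
    obtain ⟨U, hU, hsU⟩ := hP.cover s hsS
    obtain ⟨Y, hYP, hUY, hn, hc⟩ := exists_crossingConnected hU
    have hsY : s ∈ Y.sup id := Finset.mem_sup.2 ⟨U, hUY, hsU⟩
    refine ⟨⟨Y.sup id, Y, P \ Y⟩, ?_, Finset.union_sdiff_of_subset hYP⟩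
    simp only [Finset.mem_sigma, Finset.mem_filter, Finset.mem_powerset, Finset.mem_product,
      mem_connectedPartitions, mem_gapPartitions]
    refine ⟨⟨Finset.sup_le fun V hV => hP.subset V (hYP hV), hsY⟩, ⟨hP.of_subset hYP, hc⟩, ?_,
      hP.respectsGaps_of_component hYP hn hc hs hsY⟩
    rw [← hP.sup_sdiff hYP]
    exact hP.of_subset Finset.sdiff_subset
  · rintro ⟨T, Y, Z⟩ h
    simp only [Finset.mem_sigma, Finset.mem_filter, Finset.mem_powerset, Finset.mem_product,
      mem_connectedPartitions, mem_gapPartitions] at h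
    obtain ⟨⟨hT, -⟩, ⟨hY, -⟩, hZ, hg⟩ := h
    rw [card_crossings_union hY hZ Finset.disjoint_sdiff (hg.noCross hY)]

/-- No block may straddle `t`, so the partition splits into a left and a right part; the right part
lies in the last gap and is otherwise free. -/
theorem gapPoly_insert {T R R' : Finset α} {t : α} (hT : ∀ x ∈ T, x < t) (hR : ∀ x ∈ R, x < t)
    (hR' : ∀ x ∈ R', t < x) :
    gapPoly (insert t T) (R ∪ R') = gapPoly T R * crossingPoly R' := by
  classical
  have hd : Disjoint R R' := Finset.disjoint_left.2 fun x h h' => (hR x h).asymm (hR' x h')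
  rw [gapPoly, gapPoly, crossingPoly, Finset.sum_mul_sum, ← Finset.sum_product']
  simp only [← pow_add]
  symm
  refine Finset.sum_bij (fun p _ => p.1 ∪ p.2) ?_ ?_ ?_ ?_
  · rintro ⟨Y, Z⟩ h
    simp only [Finset.mem_product, mem_gapPartitions, mem_setPartitions] at h ⊢
    obtain ⟨⟨hY, hg⟩, hZ⟩ := h
    refine ⟨hY.union hZ hd, fun V hV x hx y hy u hu h1 h2 => ?_⟩
    rcases Finset.mem_union.1 hV with hV | hV
    · rcases Finset.mem_insert.1 hu with rfl | hu
      · exact (hR y (hY.subset V hV hy)).asymm h2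
      · exact hg V hV x hx y hy u hu h1 h2
    · have := hR' x (hZ.subset V hV hx)
      rcases Finset.mem_insert.1 hu with rfl | hu
      · exact this.asymm h1
      · exact (this.trans h1).asymm (hT u hu)
  · rintro ⟨Y, Z⟩ h ⟨Y', Z'⟩ h' he
    simp only [Finset.mem_product, mem_gapPartitions, mem_setPartitions] at h h' he
    have key : ∀ {Y Z}, IsPartitionOf R Y → IsPartitionOf R' Z →
        Y = (Y ∪ Z).filter (· ⊆ R) ∧ Z = (Y ∪ Z).filter (· ⊆ R') := by
      intro Y Z hY hZ
      constructor <;> ext U <;> simp only [Finset.mem_filter, Finset.mem_union]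
      · refine ⟨fun hU => ⟨Or.inl hU, hY.subset U hU⟩, fun ⟨hU, hs⟩ => hU.resolve_right ?_⟩
        intro hU
        obtain ⟨x, hx⟩ := hZ.nonempty U hU
        exact Finset.disjoint_left.1 hd (hs hx) (hZ.subset U hU hx)
      · refine ⟨fun hU => ⟨Or.inr hU, hZ.subset U hU⟩, fun ⟨hU, hs⟩ => hU.resolve_left ?_⟩
        intro hU
        obtain ⟨x, hx⟩ := hY.nonempty U hU
        exact Finset.disjoint_left.1 hd (hY.subset U hU hx) (hs hx)
    obtain ⟨a, b⟩ := key h.1.1 h.2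
    obtain ⟨a', b'⟩ := key h'.1.1 h'.2
    rw [Prod.mk.injEq]
    exact ⟨a.trans (he ▸ a'.symm), b.trans (he ▸ b'.symm)⟩
  · intro P hP
    rw [mem_gapPartitions] at hP
    obtain ⟨hP, hg⟩ := hP
    have hsplit : ∀ U ∈ P, U ⊆ R ∨ U ⊆ R' := by
      intro U hU
      by_contra hcon
      rw [not_or, Finset.not_subset, Finset.not_subset] at hcon
      obtain ⟨⟨x, hx, hxR⟩, y, hy, hyR⟩ := hcon
      have hx' := (Finset.mem_union.1 (hP.subset U hU hx)).resolve_left hxR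
      have hy' := (Finset.mem_union.1 (hP.subset U hU hy)).resolve_right hyR
      exact hg U hU y hy x hx t (Finset.mem_insert_self _ _) (hR y hy') (hR' x hx')
    have hpart : ∀ Q Q' : Finset α, Disjoint Q Q' → Q ⊆ R ∪ R' → (∀ U ∈ P, U ⊆ Q ∨ U ⊆ Q') →
        IsPartitionOf Q (P.filter (· ⊆ Q)) := by
      intro Q Q' hQ hsub hs
      refine ⟨fun U hU => hP.nonempty U (Finset.mem_filter.1 hU).1,
        fun U hU => (Finset.mem_filter.1 hU).2, fun x hx => ?_, fun U hU V hV =>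
        hP.unique U (Finset.mem_filter.1 hU).1 V (Finset.mem_filter.1 hV).1⟩
      obtain ⟨U, hU, hxU⟩ := hP.cover x (hsub hx)
      exact ⟨U, Finset.mem_filter.2 ⟨hU, (hs U hU).resolve_right fun h =>
        Finset.disjoint_left.1 hQ hx (h hxU)⟩, hxU⟩
    refine ⟨(P.filter (· ⊆ R), P.filter (· ⊆ R')), ?_, ?_⟩
    · simp only [Finset.mem_product, mem_gapPartitions, mem_setPartitions]
      refine ⟨⟨hpart R R' hd Finset.subset_union_left hsplit, fun V hV x hx y hy u hu => ?_⟩,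
        hpart R' R hd.symm Finset.subset_union_right fun U hU => (hsplit U hU).symm⟩
      exact hg V (Finset.mem_filter.1 hV).1 x hx y hy u (Finset.mem_insert_of_mem hu)
    · rw [← Finset.filter_or]
      exact Finset.filter_true_of_mem hsplit
  · rintro ⟨Y, Z⟩ h
    simp only [Finset.mem_product, mem_gapPartitions, mem_setPartitions] at h
    obtain ⟨⟨hY, hg⟩, hZ⟩ := h
    rw [card_crossings_union hY hZ hd]
    have hlt : ∀ U ∈ Y, ∀ x ∈ U, x < t := fun U hU x hx => hR x (hY.subset U hU hx)
    have hgt : ∀ U ∈ Z, ∀ x ∈ U, t < x := fun U hU x hx => hR' x (hZ.subset U hU hx)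
    intro U hU V hV
    constructor
    · rintro ⟨a, ha, b, hb, c, hc, d, -, -, h2, -⟩
      exact ((hgt V hV b hb).trans h2).asymm (hlt U hU c hc)
    · rintro ⟨a, ha, b, hb, c, hc, d, -, h1, h2, -⟩
      exact ((hgt V hV a ha).trans h1).asymm (hlt U hU b hb)

end CrossingPolynomials

/-! ### Invariance under order embeddings: only the number of points matters. -/

section Transport

open Polynomial

variable {α β : Type*} [LinearOrder α] [LinearOrder β] (f : α ↪o β)

/-- The image of a family of blocks under an order embedding. -/
def mapBlocks (X : Finset (Finset α)) : Finset (Finset β) :=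
  X.map (Finset.mapEmbedding f.toEmbedding).toEmbedding

variable {f} {S : Finset α} {X Y : Finset (Finset α)}

theorem mem_mapBlocks {V : Finset β} :
    V ∈ mapBlocks f X ↔ ∃ U ∈ X, U.map f.toEmbedding = V := by
  simp [mapBlocks]

theorem map_mem_mapBlocks {U : Finset α} :
    U.map f.toEmbedding ∈ mapBlocks f X ↔ U ∈ X := by
  rw [mem_mapBlocks]
  exact ⟨fun ⟨V, hV, h⟩ => Finset.map_injective _ h ▸ hV, fun h => ⟨U, h, rfl⟩⟩

theorem mapBlocks_injective : Function.Injective (mapBlocks f) :=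
  Finset.map_injective _

theorem mapBlocks_sdiff : mapBlocks f (X \ Y) = mapBlocks f X \ mapBlocks f Y :=
  Finset.map_sdiff ..

theorem isPartitionOf_mapBlocks :
    IsPartitionOf (S.map f.toEmbedding) (mapBlocks f X) ↔ IsPartitionOf S X := by
  constructor
  · intro h
    refine ⟨fun U hU => ?_, fun U hU => ?_, fun x hx => ?_, fun U hU V hV x hxU hxV => ?_⟩
    · simpa using h.nonempty _ (map_mem_mapBlocks.2 hU)
    · simpa using h.subset _ (map_mem_mapBlocks.2 hU)
    · obtain ⟨V, hV, hxV⟩ := h.cover (f x) (by simpa using hx)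
      obtain ⟨U, hU, rfl⟩ := mem_mapBlocks.1 hV
      exact ⟨U, hU, by simpa using hxV⟩
    · exact Finset.map_injective _ (h.unique _ (map_mem_mapBlocks.2 hU) _
        (map_mem_mapBlocks.2 hV) (f x) (by simpa using hxU) (by simpa using hxV))
  · intro h
    refine ⟨fun U hU => ?_, fun U hU => ?_, fun x hx => ?_, fun U hU V hV x hxU hxV => ?_⟩
    · obtain ⟨U, hU', rfl⟩ := mem_mapBlocks.1 hU
      simpa using h.nonempty U hU'
    · obtain ⟨U, hU', rfl⟩ := mem_mapBlocks.1 hU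
      simpa using h.subset U hU'
    · obtain ⟨x, hx', rfl⟩ := Finset.mem_map.1 hx
      obtain ⟨U, hU, hxU⟩ := h.cover x hx'
      exact ⟨_, map_mem_mapBlocks.2 hU, by simpa using hxU⟩
    · obtain ⟨U, hU', rfl⟩ := mem_mapBlocks.1 hU
      obtain ⟨V, hV', rfl⟩ := mem_mapBlocks.1 hV
      obtain ⟨x, hx, rfl⟩ := Finset.mem_map.1 hxU
      rw [h.unique U hU' V hV' x hx (by simpa using hxV)]

theorem exists_mapBlocks_eq {Z : Finset (Finset β)} (h : ∀ V ∈ Z, V ⊆ S.map f.toEmbedding) :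
    ∃ X, mapBlocks f X = Z := by
  have : Z ⊆ S.powerset.map (Finset.mapEmbedding f.toEmbedding).toEmbedding := by
    intro V hV
    obtain ⟨U, hU, rfl⟩ := Finset.subset_map_iff.1 (h V hV)
    exact Finset.mem_map.2 ⟨U, Finset.mem_powerset.2 hU, rfl⟩
  obtain ⟨X, -, rfl⟩ := Finset.subset_map_iff.1 this
  exact ⟨X, rfl⟩

theorem crosses_map {U V : Finset α} :
    Crosses (U.map f.toEmbedding) (V.map f.toEmbedding) ↔ Crosses U V := by
  simp [Crosses]

theorem noCross_mapBlocks : NoCross (mapBlocks f X) (mapBlocks f Y) ↔ NoCross X Y := by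
  simp [NoCross, mem_mapBlocks, crosses_map]

theorem crossingConnected_mapBlocks :
    CrossingConnected (mapBlocks f X) ↔ CrossingConnected X := by
  constructor
  · intro h Y hY hne hn
    refine mapBlocks_injective (h (mapBlocks f Y) (Finset.map_subset_map.2 hY)
      (Finset.map_nonempty.2 hne) ?_)
    rwa [← mapBlocks_sdiff, noCross_mapBlocks]
  · intro h Z hZ hne hn
    obtain ⟨Y, hY, rfl⟩ := Finset.subset_map_iff.1 hZ
    rw [h Y hY (Finset.map_nonempty.1 hne)]
    · rfl
    · rw [← noCross_mapBlocks (f := f), mapBlocks_sdiff]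
      exact hn

theorem card_crossings_mapBlocks : (crossings (mapBlocks f X)).card = (crossings X).card := by
  symm
  refine Finset.card_bij (fun c _ => ((f c.1.1, f c.1.2), f c.2.1, f c.2.2)) ?_ ?_ ?_
  · rintro ⟨⟨a, c⟩, b, d⟩ h
    obtain ⟨ho, U, hU, V, hV, hne, h1, h2, h3, h4⟩ := mem_crossings.1 h
    refine mem_crossings.2 ⟨by simpa using ho, _, map_mem_mapBlocks.2 hU, _,
      map_mem_mapBlocks.2 hV, fun h => hne (Finset.map_injective _ h), ?_⟩
    simpa using ⟨h1, h2, h3, h4⟩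
  · rintro ⟨⟨a, c⟩, b, d⟩ - ⟨⟨a', c'⟩, b', d'⟩ - h
    simpa using h
  · rintro ⟨⟨a, c⟩, b, d⟩ h
    obtain ⟨ho, U, hU, V, hV, hne, h1, h2, h3, h4⟩ := mem_crossings.1 h
    obtain ⟨U, hU', rfl⟩ := mem_mapBlocks.1 hU
    obtain ⟨V, hV', rfl⟩ := mem_mapBlocks.1 hV
    obtain ⟨a, ha, rfl⟩ := Finset.mem_map.1 h1
    obtain ⟨c, hc, rfl⟩ := Finset.mem_map.1 h2
    obtain ⟨b, hb, rfl⟩ := Finset.mem_map.1 h3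
    obtain ⟨d, hd, rfl⟩ := Finset.mem_map.1 h4
    refine ⟨((a, c), b, d), mem_crossings.2 ⟨by simpa using ho, U, hU', V, hV',
      fun h => hne (h ▸ rfl), ha, hc, hb, hd⟩, rfl⟩

theorem setPartitions_map (f : α ↪o β) (S : Finset α) :
    setPartitions (S.map f.toEmbedding) =
      (setPartitions S).map ⟨mapBlocks f, mapBlocks_injective⟩ := by
  ext Z
  simp only [mem_setPartitions, Finset.mem_map, Function.Embedding.coeFn_mk]
  constructor
  · intro h
    obtain ⟨X, rfl⟩ := exists_mapBlocks_eq h.subset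
    exact ⟨X, isPartitionOf_mapBlocks.1 h, rfl⟩
  · rintro ⟨X, hX, rfl⟩
    exact isPartitionOf_mapBlocks.2 hX

theorem crossingPoly_map (f : α ↪o β) (S : Finset α) :
    crossingPoly (S.map f.toEmbedding) = crossingPoly S := by
  simp [crossingPoly, setPartitions_map, card_crossings_mapBlocks]

theorem connectedPoly_map (f : α ↪o β) (S : Finset α) :
    connectedPoly (S.map f.toEmbedding) = connectedPoly S := by
  classical
  simp only [connectedPoly, connectedPartitions, setPartitions_map, Finset.filter_map,
    Finset.sum_map, Function.Embedding.coeFn_mk, card_crossings_mapBlocks]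
  refine Finset.sum_congr (Finset.filter_congr fun X _ => ?_) fun _ _ => rfl
  exact crossingConnected_mapBlocks

theorem crossingPoly_eq_of_card {n : ℕ} {S : Finset α} (h : S.card = n) :
    crossingPoly S = crossingPoly (Finset.univ : Finset (Fin n)) := by
  rw [← crossingPoly_map (S.orderEmbOfFin h), Finset.map_orderEmbOfFin_univ]

theorem connectedPoly_eq_of_card {n : ℕ} {S : Finset α} (h : S.card = n) :
    connectedPoly S = connectedPoly (Finset.univ : Finset (Fin n)) := by
  rw [← connectedPoly_map (S.orderEmbOfFin h), Finset.map_orderEmbOfFin_univ]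

end Transport

/-! ### The functional equation P(z) = K(z P(z)). -/

section FunctionalEquation

/-- The power series of the set partitions of `n` points by number of crossings. -/
noncomputable def partitionSeries : PowerSeries (Polynomial ℝ) :=
  PowerSeries.mk fun n => crossingPoly (Finset.univ : Finset (Fin n))

/-- The power series of the connected set partitions of `n` points by number of crossings. -/
noncomputable def connectedSeries : PowerSeries (Polynomial ℝ) :=
  PowerSeries.mk fun n => connectedPoly (Finset.univ : Finset (Fin n))

theorem setPartitions_empty {α : Type*} : setPartitions (∅ : Finset α) = {∅} := by
  ext X
  rw [mem_setPartitions, Finset.mem_singleton]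
  constructor
  · intro h
    refine Finset.eq_empty_of_forall_notMem fun U hU => ?_
    obtain ⟨x, hx⟩ := h.nonempty U hU
    exact absurd (h.subset U hU hx) (Finset.notMem_empty x)
  · rintro rfl
    exact ⟨by simp, by simp, by simp, by simp⟩

theorem crossings_empty {α : Type*} [LinearOrder α] :
    crossings (∅ : Finset (Finset α)) = ∅ := by
  ext c; simp [mem_crossings]

theorem crossingPoly_empty {α : Type*} [LinearOrder α] : crossingPoly (∅ : Finset α) = 1 := by
  simp [crossingPoly, setPartitions_empty, crossings_empty]

theorem gapPoly_empty {α : Type*} [LinearOrder α] (T : Finset α) : gapPoly T ∅ = 1 := by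
  classical
  rw [gapPoly, gapPartitions, setPartitions_empty, Finset.filter_true_of_mem]
  · simp [crossings_empty]
  · simp [RespectsGaps]

theorem connectedPoly_empty {α : Type*} [LinearOrder α] : connectedPoly (∅ : Finset α) = 1 := by
  classical
  rw [connectedPoly, connectedPartitions, setPartitions_empty, Finset.filter_true_of_mem]
  · simp [crossings_empty]
  · simp [CrossingConnected]

open Classical in
/-- The subsets of `{0, …, n - 1}` of size `m` that contain `0`, if `n` is positive. -/
noncomputable def rootedSubsets (n m : ℕ) : Finset (Finset ℕ) :=
  (Finset.range n).powerset.filter fun T => T.card = m ∧ (0 < n → 0 ∈ T)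

theorem mem_rootedSubsets {n m : ℕ} {T : Finset ℕ} :
    T ∈ rootedSubsets n m ↔ T ⊆ Finset.range n ∧ T.card = m ∧ (0 < n → 0 ∈ T) := by
  simp [rootedSubsets]

/-- Split off the largest element `t` of the subset: the n - 1 - t points after it form the last
gap. For t = 0 nothing is left over, which is why `rootedSubsets` drops the condition on 0 when `n`
is 0. -/
theorem sum_rootedSubsets_succ (n m : ℕ) :
    ∑ T ∈ rootedSubsets n (m + 1), gapPoly T (Finset.range n \ T) =
      ∑ t ∈ Finset.range n, (∑ T ∈ rootedSubsets t m, gapPoly T (Finset.range t \ T)) *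
        crossingPoly (Finset.univ : Finset (Fin (n - 1 - t))) := by
  simp only [Finset.sum_mul]
  rw [Finset.sum_sigma']
  symm
  have hlt : ∀ {t m : ℕ} {T : Finset ℕ}, T ∈ rootedSubsets t m → ∀ x ∈ T, x < t :=
    fun h x hx => Finset.mem_range.1 ((mem_rootedSubsets.1 h).1 hx)
  refine Finset.sum_bij (fun p _ => insert p.1 p.2) ?_ ?_ ?_ ?_
  · rintro ⟨t, T⟩ h
    obtain ⟨ht, hT⟩ := Finset.mem_sigma.1 h
    have ht' := Finset.mem_range.1 ht
    have hl := hlt hT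
    obtain ⟨-, hc, h0⟩ := mem_rootedSubsets.1 hT
    refine mem_rootedSubsets.2 ⟨Finset.insert_subset ht fun x hx =>
      Finset.mem_range.2 ((hl x hx).trans ht'), ?_, fun _ => ?_⟩
    · rw [Finset.card_insert_of_notMem fun h => (hl t h).false, hc]
    · rcases Nat.eq_zero_or_pos t with rfl | hpos
      · exact Finset.mem_insert_self _ _
      · exact Finset.mem_insert_of_mem (h0 hpos)
  · rintro ⟨t, T⟩ h ⟨t', T'⟩ h' he
    have hl := hlt (Finset.mem_sigma.1 h).2
    have hl' := hlt (Finset.mem_sigma.1 h').2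
    simp only at hl hl' he
    have htt : t = t' := by
      refine le_antisymm ?_ ?_
      · rcases Finset.mem_insert.1 (he ▸ Finset.mem_insert_self t T) with h | h
        · exact h.le
        · exact (hl' _ h).le
      · rcases Finset.mem_insert.1 (he.symm ▸ Finset.mem_insert_self t' T') with h | h
        · exact h.le
        · exact (hl _ h).le
    subst htt
    rw [← Finset.erase_insert fun h => (hl t h).false, he,
      Finset.erase_insert fun h => (hl' t h).false]
  · intro T hT
    obtain ⟨hTn, hc, h0⟩ := mem_rootedSubsets.1 hT
    have hne : T.Nonempty := Finset.card_pos.1 (by omega)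
    have hmax := T.max'_mem hne
    refine ⟨⟨T.max' hne, T.erase (T.max' hne)⟩, Finset.mem_sigma.2 ⟨hTn hmax,
      mem_rootedSubsets.2 ⟨fun x hx => Finset.mem_range.2 (T.lt_max'_of_mem_erase_max' hne hx),
        by rw [Finset.card_erase_of_mem hmax, hc]; rfl, fun hpos =>
        Finset.mem_erase.2 ⟨hpos.ne, h0 ?_⟩⟩⟩, Finset.insert_erase hmax⟩
    exact (Nat.zero_le _).trans_lt (Finset.mem_range.1 (hTn hmax))
  · rintro ⟨t, T⟩ h
    obtain ⟨ht, hT⟩ := Finset.mem_sigma.1 h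
    have ht' : t < n := Finset.mem_range.1 ht
    have hl := hlt hT
    simp only at hT hl ⊢
    have e : Finset.range n \ insert t T = (Finset.range t \ T) ∪ Finset.Ioo t n := by
      ext x
      have := hl x
      simp only [Finset.mem_sdiff, Finset.mem_range, Finset.mem_insert, Finset.mem_union,
        Finset.mem_Ioo]
      by_cases hx : x ∈ T
      · have := hl x hx
        simp [hx]; omega
      · simp [hx]; omega
    rw [e, gapPoly_insert hl (fun x hx => Finset.mem_range.1 (Finset.mem_sdiff.1 hx).1)
      fun x hx => (Finset.mem_Ioo.1 hx).1, crossingPoly_eq_of_card (S := Finset.Ioo t n) (n := n - 1 - t)]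
    rw [Nat.card_Ioo]; omega

-- Each factor z P(z) is one point of `T` followed by an arbitrary partition of the gap after it. As
-- 0 belongs to `T`, no gap precedes the first point.
open PowerSeries in
theorem coeff_X_mul_partitionSeries_pow (m : ℕ) : ∀ n,
    coeff n ((X * partitionSeries) ^ m) =
      ∑ T ∈ rootedSubsets n m, gapPoly T (Finset.range n \ T) := by
  induction m with
  | zero =>
    intro n
    rcases n with _ | n
    · have : rootedSubsets 0 0 = {∅} := by ext T; simp [mem_rootedSubsets]
      simp [this, gapPoly_empty]
    · have : rootedSubsets (n + 1) 0 = ∅ := by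
        ext T
        simp only [mem_rootedSubsets, Finset.card_eq_zero, Finset.notMem_empty, iff_false]
        rintro ⟨-, rfl, h⟩
        simp at h
      simp [this, coeff_one]
  | succ m ih =>
    intro n
    rw [sum_rootedSubsets_succ]
    rcases n with _ | n
    · simp
    · rw [pow_succ, mul_left_comm, coeff_succ_X_mul, coeff_mul,
        Finset.Nat.sum_antidiagonal_eq_sum_range_succ_mk]
      refine Finset.sum_congr rfl fun t _ => ?_
      rw [ih, partitionSeries, coeff_mk]

open PowerSeries in
theorem coeff_partitionSeries (n : ℕ) :
    coeff n partitionSeries = ∑ m ∈ Finset.range (n + 1),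
      coeff m connectedSeries * coeff n ((X * partitionSeries) ^ m) := by
  have h1 : coeff n partitionSeries = crossingPoly (Finset.range n) := by
    rw [crossingPoly_eq_of_card (Finset.card_range n), partitionSeries, coeff_mk]
  rcases n with _ | n
  · rw [h1]
    simp [connectedSeries, crossingPoly_empty, connectedPoly_empty]
  rw [h1, crossingPoly_eq_sum (s := 0) (by simp) (by simp)]
  simp only [coeff_X_mul_partitionSeries_pow, Finset.mul_sum]
  rw [Finset.sum_sigma']
  refine Finset.sum_bij' (fun T _ => ⟨T.card, T⟩) (fun p _ => p.2) ?_ ?_ ?_ ?_ ?_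
  · intro T hT
    simp only [Finset.mem_filter, Finset.mem_powerset] at hT
    have := Finset.card_le_card hT.1
    simp only [Finset.mem_sigma, mem_rootedSubsets, Finset.mem_range, Finset.card_range] at *
    exact ⟨by omega, hT.1, trivial, fun _ => hT.2⟩
  · rintro ⟨m, T⟩ h
    simp only [Finset.mem_sigma, mem_rootedSubsets] at h
    exact Finset.mem_filter.2 ⟨Finset.mem_powerset.2 h.2.1, h.2.2.2 n.succ_pos⟩
  · intro T _; rfl
  · rintro ⟨m, T⟩ h
    simp only [Finset.mem_sigma, mem_rootedSubsets] at h
    obtain ⟨-, -, rfl, -⟩ := h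
    rfl
  · intro T _
    rw [connectedSeries, coeff_mk, connectedPoly_eq_of_card rfl]

open PowerSeries in
theorem succ_mul_crossingPoly (n : ℕ) :
    ((n : Polynomial ℝ) + 1) * crossingPoly (Finset.univ : Finset (Fin n)) =
      coeff n (connectedSeries ^ (n + 1)) := by
  rw [← succ_mul_coeff_of_fixedPoint coeff_partitionSeries, partitionSeries, coeff_mk]

end FunctionalEquation

/-! ### Identification with `partitionCount`. -/

section PartitionCount

open Polynomial

theorem Finpartition.isPartitionOf_parts {α : Type*} [DecidableEq α] {S : Finset α}
    (P : Finpartition S) : IsPartitionOf S P.parts where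
  nonempty _ hU := P.nonempty_of_mem_parts hU
  subset _ hU := P.le hU
  cover _ hx := P.exists_mem hx
  unique _ hU _ hV _ hxU hxV := P.eq_of_mem_parts hU hV hxU hxV

theorem IsPartitionOf.exists_finpartition {α : Type*} [DecidableEq α] {S : Finset α}
    {X : Finset (Finset α)} (h : IsPartitionOf S X) : ∃ P : Finpartition S, P.parts = X := by
  refine ⟨⟨X, Finset.supIndep_iff_pairwiseDisjoint.2 fun U hU V hV hne => ?_, h.sup_eq,
    fun hb => (h.nonempty _ hb).ne_empty rfl⟩, rfl⟩
  exact Finset.disjoint_left.2 fun x hx hx' => hne (h.unique U hU V hV x hx hx')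

theorem crossings_parts {n : ℕ} (P : Finpartition (Finset.univ : Finset (Fin n))) :
    crossings P.parts = partitionCrossings P := by
  ext c
  simp [mem_crossings, partitionCrossings]

theorem coeff_sum_X_pow_card {ι : Type*} (s : Finset ι) (f : ι → ℕ) (k : ℕ) :
    (∑ i ∈ s, (X : ℝ[X]) ^ f i).coeff k = (s.filter fun i => f i = k).card := by
  simp only [finsetSum_coeff, coeff_X_pow, Finset.sum_boole, eq_comm]

theorem coeff_crossingPoly (k n : ℕ) :
    (crossingPoly (Finset.univ : Finset (Fin n))).coeff k = partitionCount k n := by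
  rw [crossingPoly, coeff_sum_X_pow_card, partitionCount, Nat.cast_inj]
  symm
  refine Finset.card_bij (fun P _ => P.parts) ?_ ?_ ?_
  · intro P hP
    simp only [Finset.mem_filter, mem_setPartitions] at hP ⊢
    exact ⟨P.isPartitionOf_parts, by rw [crossings_parts]; exact hP.2⟩
  · exact fun P _ Q _ h => Finpartition.ext h
  · intro X hX
    simp only [Finset.mem_filter, mem_setPartitions] at hX
    obtain ⟨P, rfl⟩ := hX.1.exists_finpartition
    exact ⟨P, by simpa [crossings_parts] using hX.2, rfl⟩

end PartitionCount

/-! ### Connected partitions with few crossings. -/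

section ConnectedPartitions

open Polynomial

variable {α : Type*} [LinearOrder α] {S : Finset α} {P : Finset (Finset α)}

theorem isPartitionOf_singleton {α : Type*} {S : Finset α} (hS : S.Nonempty) : IsPartitionOf S {S} where
  nonempty U hU := by rwa [Finset.mem_singleton.1 hU]
  subset U hU := by rw [Finset.mem_singleton.1 hU]
  cover x hx := ⟨S, Finset.mem_singleton_self S, hx⟩
  unique U hU V hV _ _ _ := by rw [Finset.mem_singleton.1 hU, Finset.mem_singleton.1 hV]

theorem crossingConnected_singleton : CrossingConnected {S} := by
  intro Y hY hne _
  exact (Finset.subset_singleton_iff.1 hY).resolve_left hne.ne_empty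

theorem crossings_singleton : crossings {S} = ∅ := by
  ext c
  simp [mem_crossings]

/-- Otherwise `{U}` would be a component by itself. -/
theorem CrossingConnected.exists_crosses (hc : CrossingConnected P) {U : Finset α} (hU : U ∈ P)
    (hne : P ≠ {U}) : ∃ V ∈ P, U ≠ V ∧ (Crosses U V ∨ Crosses V U) := by
  by_contra! hcon
  refine hne (hc {U} (Finset.singleton_subset_iff.2 hU) ⟨U, Finset.mem_singleton_self U⟩ ?_).symm
  intro U' hU' V hV
  obtain rfl := Finset.mem_singleton.1 hU'
  rw [Finset.mem_sdiff, Finset.mem_singleton] at hV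
  exact hcon V hV.1 (Ne.symm hV.2)

theorem IsPartitionOf.eq_singleton (hP : IsPartitionOf S P) {U : Finset α} (h : P = {U}) :
    U = S := by
  rw [← hP.sup_eq, h, Finset.sup_singleton, id]

theorem CrossingConnected.eq_singleton_of_crossings_eq_empty (hP : IsPartitionOf S P)
    (hc : CrossingConnected P) (hS : S.Nonempty) (h0 : crossings P = ∅) : P = {S} := by
  obtain ⟨x, hx⟩ := hS
  obtain ⟨U, hU, -⟩ := hP.cover x hx
  have hPU : P = {U} := by
    by_contra hne
    obtain ⟨V, hV, hUV, ⟨a, ha, b, hb, c, hc, d, hd, ho⟩ | ⟨a, ha, b, hb, c, hc, d, hd, ho⟩⟩ :=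
      hc.exists_crosses hU hne
    · exact Finset.notMem_empty ((a, c), b, d)
        (h0 ▸ mem_crossings.2 ⟨ho, U, hU, V, hV, hUV, ha, hc, hb, hd⟩)
    · exact Finset.notMem_empty ((a, c), b, d)
        (h0 ▸ mem_crossings.2 ⟨ho, V, hV, U, hU, hUV.symm, ha, hc, hb, hd⟩)
  rw [hPU, hP.eq_singleton hPU]

/-- The four endpoints of a pair of chords. -/
def crossingPoints (c : (α × α) × (α × α)) : Finset α := {c.1.1, c.1.2, c.2.1, c.2.2}

/-- In a connected partition with a crossing every point is an endpoint of a crossing chord. -/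
theorem CrossingConnected.exists_mem_crossingPoints (hP : IsPartitionOf S P)
    (hc : CrossingConnected P) (h0 : crossings P ≠ ∅) {x : α} (hx : x ∈ S) :
    ∃ c ∈ crossings P, x ∈ crossingPoints c := by
  obtain ⟨U, hU, hxU⟩ := hP.cover x hx
  have hne : P ≠ {U} := by
    rintro rfl
    exact h0 crossings_singleton
  obtain ⟨V, hV, hUV, h⟩ := hc.exists_crosses hU hne
  have hxV : ∀ v ∈ V, x ≠ v := fun v hv h => hUV (hP.unique U hU V hV x hxU (h ▸ hv))
  have mk : ∀ a b c d, a < b → b < c → c < d → a ∈ U → c ∈ U → b ∈ V → d ∈ V →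
      x ∈ crossingPoints ((a, c), b, d) → ∃ c ∈ crossings P, x ∈ crossingPoints c :=
    fun a b c d h1 h2 h3 ha hc hb hd h =>
      ⟨_, mem_crossings.2 ⟨⟨h1, h2, h3⟩, U, hU, V, hV, hUV, ha, hc, hb, hd⟩, h⟩
  have mk' : ∀ a b c d, a < b → b < c → c < d → a ∈ V → c ∈ V → b ∈ U → d ∈ U →
      x ∈ crossingPoints ((a, c), b, d) → ∃ c ∈ crossings P, x ∈ crossingPoints c :=
    fun a b c d h1 h2 h3 ha hc hb hd h =>
      ⟨_, mem_crossings.2 ⟨⟨h1, h2, h3⟩, V, hV, U, hU, hUV.symm, ha, hc, hb, hd⟩, h⟩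
  -- The two points of `V` separate the two points of `U`. Wherever `x` lies, it can replace the
  -- point of `U` on its own side of the chord of `V`.
  rcases h with ⟨a, ha, b, hb, c, hc, d, hd, h1, h2, h3⟩ | ⟨a, ha, b, hb, c, hc, d, hd, h1, h2, h3⟩
  · rcases lt_or_gt_of_ne (hxV b hb) with h | h
    · exact mk x b c d h h2 h3 hxU hc hb hd (by simp [crossingPoints])
    rcases lt_or_gt_of_ne (hxV d hd) with h' | h'
    · exact mk a b x d h1 h h' ha hxU hb hd (by simp [crossingPoints])
    · exact mk' b c d x h2 h3 h' hb hd hc hxU (by simp [crossingPoints])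
  · rcases lt_or_gt_of_ne (hxV a ha) with h | h
    · exact mk x a b c h h1 h2 hxU hb ha hc (by simp [crossingPoints])
    rcases lt_or_gt_of_ne (hxV c hc) with h' | h'
    · exact mk' a x c d h h' h3 ha hc hxU hd (by simp [crossingPoints])
    · exact mk' a b c x h1 h2 h' ha hc hb hxU (by simp [crossingPoints])

/-- The endpoints of the crossings, four for each, cover `S`. -/
theorem CrossingConnected.card_le (hP : IsPartitionOf S P) (hc : CrossingConnected P)
    (h0 : crossings P ≠ ∅) : S.card ≤ 4 * (crossings P).card := by
  have : S ⊆ (crossings P).biUnion crossingPoints := fun x hx =>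
    Finset.mem_biUnion.2 (hc.exists_mem_crossingPoints hP h0 hx)
  rw [mul_comm]
  exact (Finset.card_le_card this).trans
    (Finset.card_biUnion_le_card_mul _ _ _ fun c _ => Finset.card_le_four)

theorem IsPartitionOf.four_le_card (hP : IsPartitionOf S P) (h0 : (crossings P).Nonempty) :
    4 ≤ S.card := by
  obtain ⟨⟨⟨a, c⟩, b, d⟩, hc⟩ := h0
  obtain ⟨⟨h1, h2, h3⟩, U, hU, V, hV, -, ha, hc, hb, hd⟩ := mem_crossings.1 hc
  simp only at *
  have hsub : ({a, b, c, d} : Finset α) ⊆ S := by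
    simp only [Finset.insert_subset_iff, Finset.singleton_subset_iff]
    exact ⟨hP.subset U hU ha, hP.subset V hV hb, hP.subset U hU hc, hP.subset V hV hd⟩
  refine le_trans (le_of_eq ?_) (Finset.card_le_card hsub)
  have h13 := h1.trans h2
  have h24 := h2.trans h3
  have h14 := h1.trans h24
  rw [Finset.card_insert_of_notMem, Finset.card_insert_of_notMem, Finset.card_insert_of_notMem,
    Finset.card_singleton]
  · simp [h3.ne]
  · simp [h2.ne, h24.ne]
  · simp [h1.ne, h13.ne, h14.ne]

theorem coeff_connectedPoly (j : ℕ) : (connectedPoly S).coeff j =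
    ((connectedPartitions S).filter fun P => (crossings P).card = j).card :=
  coeff_sum_X_pow_card _ _ _

/-- Only the one-block partition (or the empty one) is connected without crossings, so the q^0 part
of K is 1/(1-w). -/
theorem coeff_zero_connectedPoly (S : Finset α) : (connectedPoly S).coeff 0 = 1 := by
  rcases S.eq_empty_or_nonempty with rfl | hS
  · simp [connectedPoly_empty]
  rw [coeff_connectedPoly]
  norm_cast
  refine Finset.card_eq_one.2 ⟨{S}, ?_⟩
  ext P
  rw [Finset.mem_filter, mem_connectedPartitions, Finset.mem_singleton, Finset.card_eq_zero]
  constructor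
  · rintro ⟨⟨hP, hc⟩, h0⟩
    exact hc.eq_singleton_of_crossings_eq_empty hP hS h0
  · rintro rfl
    exact ⟨⟨isPartitionOf_singleton hS, crossingConnected_singleton⟩, crossings_singleton⟩

theorem coeff_connectedPoly_eq_zero {j : ℕ} (hj : j ≠ 0) (h : 4 * j < S.card) :
    (connectedPoly S).coeff j = 0 := by
  rw [coeff_connectedPoly]
  norm_cast
  rw [Finset.card_eq_zero, Finset.filter_eq_empty_iff]
  rintro P hP rfl
  rw [mem_connectedPartitions] at hP
  have := hP.2.card_le hP.1 (by rintro h; simp [h] at hj)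
  omega

theorem coeff_one_connectedPoly_eq_zero (h : S.card ≠ 4) : (connectedPoly S).coeff 1 = 0 := by
  rcases lt_or_gt_of_ne h with h | h
  · rw [coeff_connectedPoly]
    norm_cast
    rw [Finset.card_eq_zero, Finset.filter_eq_empty_iff]
    intro P hP hc
    rw [mem_connectedPartitions] at hP
    have := hP.1.four_le_card (Finset.card_pos.1 (by omega))
    omega
  · exact coeff_connectedPoly_eq_zero one_ne_zero (by omega)

theorem coeff_one_connectedPoly_four :
    (connectedPoly (Finset.univ : Finset (Fin 4))).coeff 1 = 1 := by
  rw [coeff_connectedPoly]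
  norm_cast
  refine Finset.card_eq_one.2 ⟨{{0, 2}, {1, 3}}, ?_⟩
  ext P
  rw [Finset.mem_filter, mem_connectedPartitions, Finset.mem_singleton]
  constructor
  · rintro ⟨⟨hP, -⟩, h1⟩
    obtain ⟨⟨⟨a, c⟩, b, d⟩, hmem⟩ := Finset.card_pos.1 (h1 ▸ Nat.one_pos)
    obtain ⟨⟨h1, h2, h3⟩, U, hU, V, hV, hUV, ha, hc, hb, hd⟩ := mem_crossings.1 hmem
    simp only at *
    obtain rfl : a = 0 := by omega
    obtain rfl : b = 1 := by omega
    obtain rfl : c = 2 := by omega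
    obtain rfl : d = 3 := by omega
    have hdisj : ∀ x, x ∈ U → x ∉ V := fun x h h' => hUV (hP.unique U hU V hV x h h')
    have e1 : U = {0, 2} := by
      ext x
      have h1 : (1 : Fin 4) ∉ U := fun h => hdisj 1 h hb
      have h3 : (3 : Fin 4) ∉ U := fun h => hdisj 3 h hd
      fin_cases x <;> simp [ha, hc, h1, h3]
    have e2 : V = {1, 3} := by
      ext x
      have h0 : (0 : Fin 4) ∉ V := hdisj 0 ha
      have h2 : (2 : Fin 4) ∉ V := hdisj 2 hc
      fin_cases x <;> simp [hb, hd, h0, h2]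
    ext W
    rw [← e1, ← e2, Finset.mem_insert, Finset.mem_singleton]
    refine ⟨fun hW => ?_, by rintro (rfl | rfl) <;> assumption⟩
    obtain ⟨x, hx⟩ := hP.nonempty W hW
    have hall : ∀ x : Fin 4, x ∈ U ∨ x ∈ V := by rw [e1, e2]; decide
    exact (hall x).imp (hP.unique W hW U hU x hx) (hP.unique W hW V hV x hx)
  · rintro rfl
    have hcross : crossings ({{0, 2}, {1, 3}} : Finset (Finset (Fin 4))) = {((0, 2), 1, 3)} := by
      ext ⟨⟨a, c⟩, b, d⟩
      rw [mem_crossings, Finset.mem_singleton]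
      revert a b c d; decide
    refine ⟨⟨⟨by decide, by decide, by decide, by decide⟩, ?_⟩, by rw [hcross]; rfl⟩
    have hc : Crosses ({0, 2} : Finset (Fin 4)) {1, 3} := by
      refine ⟨0, by simp, 1, by simp, 2, by simp, 3, by simp, by decide⟩
    intro Y hY hne hn
    by_contra hYne
    obtain ⟨U, hU⟩ := hne
    have hmem := hY hU
    obtain ⟨V, hV, hVY⟩ := Finset.not_subset.1 fun h => hYne (hY.antisymm h)
    have := hn U hU V (Finset.mem_sdiff.2 ⟨hV, hVY⟩)
    simp only [Finset.mem_insert, Finset.mem_singleton] at hmem hV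
    rcases hmem with rfl | rfl <;> rcases hV with rfl | rfl
    · exact hVY hU
    · exact this.1 hc
    · exact this.2 hc
    · exact hVY hU

end ConnectedPartitions

/-! ### Extraction of the coefficient of q^k w^n from K^(n+1). -/

section CoefficientExtraction

open PowerSeries

/-- The coefficient of `q ^ j * w ^ i`. -/
noncomputable def biCoeff (F : (Polynomial ℝ)⟦X⟧) (j i : ℕ) : ℝ := (coeff i F).coeff j

theorem biCoeff_mul (F G : (Polynomial ℝ)⟦X⟧) (j i : ℕ) :
    biCoeff (F * G) j i = ∑ p ∈ Finset.HasAntidiagonal.antidiagonal i,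
      ∑ q ∈ Finset.HasAntidiagonal.antidiagonal j, biCoeff F q.1 p.1 * biCoeff G q.2 p.2 := by
  simp only [biCoeff, coeff_mul, Polynomial.finsetSum_coeff, Polynomial.coeff_mul]

theorem biCoeff_one (j i : ℕ) : biCoeff 1 j i = if i = 0 ∧ j = 0 then 1 else 0 := by
  rw [biCoeff, coeff_one]
  split_ifs with h1 h2 h2 <;> simp_all [Polynomial.coeff_one]

/-- The part of `connectedSeries` of positive degree in the number of crossings. -/
noncomputable def crossedSeries : (Polynomial ℝ)⟦X⟧ := connectedSeries - mk 1

theorem biCoeff_crossedSeries (j i : ℕ) : biCoeff crossedSeries j i =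
    (connectedPoly (Finset.univ : Finset (Fin i))).coeff j - if j = 0 then 1 else 0 := by
  simp [biCoeff, crossedSeries, connectedSeries, Polynomial.coeff_one]

theorem biCoeff_crossedSeries_zero (i : ℕ) : biCoeff crossedSeries 0 i = 0 := by
  simp [biCoeff_crossedSeries, coeff_zero_connectedPoly]

theorem biCoeff_crossedSeries_one (i : ℕ) :
    biCoeff crossedSeries 1 i = if i = 4 then 1 else 0 := by
  rw [biCoeff_crossedSeries, if_neg one_ne_zero, sub_zero]
  split_ifs with h
  · subst h; exact coeff_one_connectedPoly_four
  · exact coeff_one_connectedPoly_eq_zero (by simpa using h)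

theorem biCoeff_crossedSeries_eq_zero {j i : ℕ} (h : 4 * j < i) :
    biCoeff crossedSeries j i = 0 := by
  rcases Nat.eq_zero_or_pos j with rfl | hj
  · exact biCoeff_crossedSeries_zero i
  · rw [biCoeff_crossedSeries, if_neg hj.ne',
      coeff_connectedPoly_eq_zero hj.ne' (by simpa using h), sub_zero]

/-- Having degree at most 4j in `w` at each q^j is preserved by products. -/
theorem biCoeff_crossedSeries_pow_eq_zero (r : ℕ) : ∀ {j i : ℕ}, 4 * j < i →
    biCoeff (crossedSeries ^ r) j i = 0 := by
  induction r with
  | zero => intro j i h; rw [pow_zero, biCoeff_one, if_neg (by omega)]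
  | succ r ih =>
    intro j i h
    rw [pow_succ, biCoeff_mul]
    refine Finset.sum_eq_zero fun p hp => Finset.sum_eq_zero fun q hq => ?_
    rw [Finset.HasAntidiagonal.mem_antidiagonal] at hp hq
    by_cases h1 : 4 * q.1 < p.1
    · rw [ih h1, zero_mul]
    · rw [biCoeff_crossedSeries_eq_zero (by omega), mul_zero]

theorem biCoeff_crossedSeries_pow_of_lt (r : ℕ) : ∀ {j : ℕ} (i : ℕ), j < r →
    biCoeff (crossedSeries ^ r) j i = 0 := by
  induction r with
  | zero => intro j i h; omega
  | succ r ih =>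
    intro j i h
    rw [pow_succ, biCoeff_mul]
    refine Finset.sum_eq_zero fun p _ => Finset.sum_eq_zero fun q hq => ?_
    rw [Finset.HasAntidiagonal.mem_antidiagonal] at hq
    by_cases h1 : q.1 < r
    · rw [ih _ h1, zero_mul]
    · rw [show q.2 = 0 by omega, biCoeff_crossedSeries_zero, mul_zero]

/-- The lowest term in `q` of D is q w^4, so that of D^r is q^r w^(4r). -/
theorem biCoeff_crossedSeries_pow_self (r : ℕ) : ∀ i : ℕ,
    biCoeff (crossedSeries ^ r) r i = if i = 4 * r then 1 else 0 := by
  induction r with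
  | zero => intro i; rw [pow_zero, biCoeff_one]; simp
  | succ r ih =>
    intro i
    have h : ∀ p ∈ Finset.HasAntidiagonal.antidiagonal i,
        ∑ q ∈ Finset.HasAntidiagonal.antidiagonal (r + 1),
          biCoeff (crossedSeries ^ r) q.1 p.1 * biCoeff crossedSeries q.2 p.2 =
        if p = (4 * r, 4) then 1 else 0 := by
      intro p _
      rw [Finset.sum_eq_single (r, 1)]
      · rw [ih, biCoeff_crossedSeries_one]
        obtain ⟨a, b⟩ := p
        simp only [Prod.mk.injEq]
        split_ifs <;> simp_all
      · intro q hq hne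
        rw [Finset.HasAntidiagonal.mem_antidiagonal] at hq
        by_cases h1 : q.1 < r
        · rw [biCoeff_crossedSeries_pow_of_lt _ _ h1, zero_mul]
        · have : q.2 = 0 := by
            by_contra h2
            exact hne (Prod.ext (by simp; omega) (by simp; omega))
          rw [this, biCoeff_crossedSeries_zero, mul_zero]
      · intro h
        simp at h
    rw [pow_succ, biCoeff_mul, Finset.sum_congr rfl h, Finset.sum_ite_eq']
    simp only [Finset.HasAntidiagonal.mem_antidiagonal]
    congr 1
    exact propext ⟨fun h => by omega, fun h => by omega⟩

/-- Here `mk 1` is 1/(1-w), whose powers have binomial coefficients. The degree bound on D^r leaves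
a number of terms independent of `n`, so limits can be taken termwise. -/
theorem biCoeff_crossedSeries_pow_mul {k n r : ℕ} (h : 4 * k ≤ n) (hr : r ≤ n) :
    biCoeff (crossedSeries ^ r * mk 1 ^ (n + 1 - r)) k n =
      ∑ i ∈ Finset.range (4 * k + 1), biCoeff (crossedSeries ^ r) k i *
        ((n - r + (n - i)).choose (n - r) : ℝ) := by
  have hterm : ∀ i, (coeff i (crossedSeries ^ r) *
      coeff (n - i) (mk 1 ^ (n + 1 - r) : (Polynomial ℝ)⟦X⟧)).coeff k =
      biCoeff (crossedSeries ^ r) k i * ((n - r + (n - i)).choose (n - r) : ℝ) := by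
    intro i
    rw [show n + 1 - r = n - r + 1 by omega, mk_one_pow_eq_mk_choose_add, coeff_mk,
      ← Polynomial.C_eq_natCast, Polynomial.coeff_mul_C, biCoeff]
  rw [biCoeff, coeff_mul, Polynomial.finsetSum_coeff,
    Finset.Nat.sum_antidiagonal_eq_sum_range_succ_mk]
  simp only [hterm]
  symm
  refine Finset.sum_subset (Finset.range_mono (Nat.succ_le_succ h)) fun i _ hi => ?_
  rw [biCoeff_crossedSeries_pow_eq_zero _ (by simpa using hi), zero_mul]

/-- The number of partitions with `k` crossings as a combination of binomial coefficients. -/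
theorem succ_mul_partitionCount {k n : ℕ} (h : 4 * k ≤ n) :
    ((n : ℝ) + 1) * partitionCount k n = ∑ r ∈ Finset.range (k + 1), ((n + 1).choose r : ℝ) *
      ∑ i ∈ Finset.range (4 * k + 1), biCoeff (crossedSeries ^ r) k i *
        ((n - r + (n - i)).choose (n - r) : ℝ) := by
  have h1 : ((n : ℝ) + 1) * partitionCount k n = biCoeff (connectedSeries ^ (n + 1)) k n := by
    rw [biCoeff, ← succ_mul_crossingPoly, ← coeff_crossingPoly, ← Polynomial.coeff_C_mul]
    simp
  have hterm : ∀ r, biCoeff (crossedSeries ^ r * mk 1 ^ (n + 1 - r) * ((n + 1).choose r : (Polynomial ℝ)⟦X⟧)) k n =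
      ((n + 1).choose r : ℝ) * biCoeff (crossedSeries ^ r * mk 1 ^ (n + 1 - r)) k n := by
    intro r
    rw [biCoeff, biCoeff, mul_comm _ (((n + 1).choose r : ℕ) : (Polynomial ℝ)⟦X⟧), ← map_natCast (C (R := Polynomial ℝ)), coeff_C_mul,
      ← Polynomial.coeff_C_mul]
    simp
  have hsum : biCoeff (connectedSeries ^ (n + 1)) k n = ∑ r ∈ Finset.range (n + 1 + 1),
      ((n + 1).choose r : ℝ) * biCoeff (crossedSeries ^ r * mk 1 ^ (n + 1 - r)) k n := by
    have hK : connectedSeries = crossedSeries + mk 1 := by rw [crossedSeries, sub_add_cancel]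
    rw [hK, add_pow, biCoeff, map_sum, Polynomial.finsetSum_coeff]
    exact Finset.sum_congr rfl fun r _ => hterm r
  -- Terms with r > k vanish, as D^r is divisible by q^r.
  rw [h1, hsum, ← Finset.sum_subset (s₁ := Finset.range (k + 1)) (Finset.range_mono (by omega))]
  · refine Finset.sum_congr rfl fun r hr => ?_
    rw [Finset.mem_range] at hr
    rw [biCoeff_crossedSeries_pow_mul h (by omega)]
  · intro r _ hr
    have hkr : k < r := by simpa using hr
    rw [biCoeff_mul]
    refine mul_eq_zero_of_right _ (Finset.sum_eq_zero fun p _ => Finset.sum_eq_zero fun q hq => ?_)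
    rw [Finset.HasAntidiagonal.mem_antidiagonal] at hq
    rw [biCoeff_crossedSeries_pow_of_lt _ _ (by omega), zero_mul]

end CoefficientExtraction

/-! ### Asymptotics of the binomial sum. -/

section Asymptotics

open Filter Topology Real

/-- For n > 0 the sequence is exactly `stirlingSeq (2n) / stirlingSeq n ^ 2`. -/
theorem tendsto_centralBinom_mul_sqrt_div :
    Tendsto (fun n : ℕ => (n.centralBinom : ℝ) * √n / 4 ^ n) atTop (𝓝 (1 / √π)) := by
  have h1 := Stirling.tendsto_stirlingSeq_sqrt_pi
  have h2 : Tendsto (fun n : ℕ => Stirling.stirlingSeq (2 * n)) atTop (𝓝 √π) :=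
    h1.comp (tendsto_id.const_mul_atTop' two_pos)
  have hpi : √π ≠ 0 := (sqrt_pos.2 pi_pos).ne'
  have h3 := h2.div (h1.pow 2) (pow_ne_zero 2 hpi)
  have e : √π / √π ^ 2 = 1 / √π := by field_simp
  rw [e] at h3
  refine h3.congr' ?_
  filter_upwards [eventually_gt_atTop 0] with n hn
  have hn' : (0 : ℝ) < n := by exact_mod_cast hn
  have hfac : ((n.centralBinom : ℕ) : ℝ) * ((n.factorial : ℝ) * n.factorial) =
      ((2 * n).factorial : ℝ) := by
    have := Nat.choose_mul_factorial_mul_factorial (n := 2 * n) (k := n) (by omega)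
    rw [show 2 * n - n = n by omega] at this
    rw [Nat.centralBinom]
    exact_mod_cast (mul_assoc _ _ _).symm.trans this
  have hs4 : √(2 * ((2 * n : ℕ) : ℝ)) = 2 * √n := by
    rw [show 2 * ((2 * n : ℕ) : ℝ) = 2 ^ 2 * n by push_cast; ring,
      sqrt_mul (by positivity), sqrt_sq (by positivity)]
  have hs2 : √(2 * (n : ℝ)) ^ 2 = 2 * n := sq_sqrt (by positivity)
  have hsn : √(n : ℝ) ^ 2 = n := sq_sqrt hn'.le
  have hpow : (((2 * n : ℕ) : ℝ) / exp 1) ^ (2 * n) = 4 ^ n * ((n / exp 1) ^ n) ^ 2 := by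
    rw [pow_mul, ← pow_mul (n / exp 1), mul_comm n 2, pow_mul, ← mul_pow]
    congr 1; push_cast; ring
  have hf : (n.factorial : ℝ) ≠ 0 := by exact_mod_cast n.factorial_ne_zero
  have hE : ((n : ℝ) / exp 1) ^ n ≠ 0 := by positivity
  have hsp : √(n : ℝ) ≠ 0 := (sqrt_pos.2 hn').ne'
  simp only [Pi.div_apply, Stirling.stirlingSeq]
  rw [hs4, hpow, ← hfac]
  generalize ((n : ℝ) / exp 1) ^ n = E at *
  rw [div_pow, mul_pow, hs2]
  generalize √(n : ℝ) = s at *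
  rw [← hsn]
  field_simp

theorem tendsto_sub_div_sub_add_sub (a b : ℕ) :
    Tendsto (fun n : ℕ => ((n : ℝ) - a) / (n - a + (n - b))) atTop (𝓝 (1 / 2)) := by
  have ha := tendsto_const_div_atTop_nhds_zero_nat (a : ℝ)
  have hb := tendsto_const_div_atTop_nhds_zero_nat (b : ℝ)
  have h := (tendsto_const_nhds (x := (1 : ℝ)).sub ha).div
    ((tendsto_const_nhds (x := (1 : ℝ)).sub ha).add (tendsto_const_nhds (x := (1 : ℝ)).sub hb))
    (by norm_num)
  rw [show (1 - 0 : ℝ) / (1 - 0 + (1 - 0)) = 1 / 2 by norm_num] at h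
  refine h.congr' ?_
  filter_upwards [eventually_gt_atTop 0] with n hn
  have hn' : (n : ℝ) ≠ 0 := by exact_mod_cast hn.ne'
  simp only [Pi.div_apply]
  rw [← mul_div_mul_left _ _ hn']
  congr 1 <;> field_simp

/-- The ratio of the two binomials is (n-a)/((n-a)+(n-b)), which tends to 1/2. -/
theorem tendsto_choose_succ {a b : ℕ} {L : ℝ}
    (h : Tendsto (fun n : ℕ => ((n - a + (n - b)).choose (n - a) : ℝ) * √n / 4 ^ n) atTop (𝓝 L)) :
    Tendsto (fun n : ℕ => ((n - (a + 1) + (n - b)).choose (n - (a + 1)) : ℝ) * √n / 4 ^ n)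
      atTop (𝓝 (L / 2)) := by
  have h' := h.mul (tendsto_sub_div_sub_add_sub a b)
  rw [mul_one_div] at h'
  refine h'.congr' ?_
  filter_upwards [eventually_gt_atTop (a + b)] with n hn
  obtain ⟨m, hm⟩ := Nat.exists_eq_add_of_le (show a + 1 ≤ n by omega)
  obtain ⟨l, hl⟩ := Nat.exists_eq_add_of_le (show b ≤ n by omega)
  rw [show n - a = m + 1 by omega, show n - (a + 1) = m by omega, show n - b = l by omega]
  have e1 : (n : ℝ) - a = m + 1 := by rw [hm]; push_cast; ring
  have e2 : (n : ℝ) - b = l := by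
    rw [sub_eq_iff_eq_add, add_comm]; exact_mod_cast hl
  rw [e1, e2]
  have h3 := Nat.add_one_mul_choose_eq (m + l) m
  rw [show m + l + 1 = m + 1 + l by ring] at h3
  have h4 : ((m : ℝ) + 1 + l) * (m + l).choose m = (m + 1 + l).choose (m + 1) * (m + 1) := by
    exact_mod_cast h3
  have hpos : (m : ℝ) + 1 + l ≠ 0 := by positivity
  rw [div_mul_div_comm, div_eq_div_iff (by positivity) (by positivity)]
  linear_combination (-(√(n : ℝ)) * 4 ^ n) * h4

/-- Start from the central binomial; each unit added to `a` or, by symmetry, to `b` halves the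
limit. -/
theorem tendsto_choose_sub (a b : ℕ) :
    Tendsto (fun n : ℕ => ((n - a + (n - b)).choose (n - a) : ℝ) * √n / 4 ^ n) atTop
      (𝓝 (1 / √π / 2 ^ (a + b))) := by
  induction a with
  | zero =>
    induction b with
    | zero =>
      simpa [Nat.centralBinom, two_mul] using tendsto_centralBinom_mul_sqrt_div
    | succ b ih =>
      have h : Tendsto (fun n : ℕ => ((n - b + (n - 0)).choose (n - b) : ℝ) * √n / 4 ^ n) atTop
          (𝓝 (1 / √π / 2 ^ (0 + b))) := by
        refine ih.congr fun n => ?_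
        rw [Nat.choose_symm_add, add_comm]
      have h' := tendsto_choose_succ h
      rw [div_div, ← pow_succ, add_assoc] at h'
      refine h'.congr fun n => ?_
      rw [Nat.choose_symm_add, add_comm]
  | succ a ih =>
    have h' := tendsto_choose_succ ih
    rwa [div_div, ← pow_succ, show a + b + 1 = a + 1 + b by ring] at h'

theorem tendsto_succ_choose_div_pow {k r : ℕ} (h : r ≤ k) :
    Tendsto (fun n : ℕ => ((n + 1).choose r : ℝ) / ((n : ℝ) + 1) ^ k) atTop
      (𝓝 (if r = k then 1 / (k.factorial : ℝ) else 0)) := by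
  have h0 : Tendsto (fun n : ℕ => ((n.choose r : ℕ) : ℝ) / (n : ℝ) ^ r) atTop
      (𝓝 (1 / (r.factorial : ℝ))) := by
    have h1 := (Asymptotics.isEquivalent_iff_tendsto_one ?_).1 (isEquivalent_choose r)
    · have h2 := h1.mul_const (1 / (r.factorial : ℝ))
      rw [one_mul] at h2
      refine h2.congr' ?_
      filter_upwards [eventually_gt_atTop 0] with n hn
      have hn' : (n : ℝ) ≠ 0 := by exact_mod_cast hn.ne'
      have hf : (r.factorial : ℝ) ≠ 0 := by exact_mod_cast r.factorial_ne_zero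
      simp only [Pi.div_apply]
      field_simp
    · filter_upwards [eventually_gt_atTop 0] with n hn
      have hn' : (0 : ℝ) < n := by exact_mod_cast hn
      have hf : (0 : ℝ) < r.factorial := by exact_mod_cast r.factorial_pos
      positivity
  have h1 : Tendsto (fun n : ℕ => ((n + 1).choose r : ℝ) / ((n : ℝ) + 1) ^ r) atTop
      (𝓝 (1 / (r.factorial : ℝ))) := by
    have := (tendsto_add_atTop_iff_nat 1).2 h0
    simpa using this
  split_ifs with hr
  · subst hr; exact h1
  · have h2 : Tendsto (fun n : ℕ => 1 / ((n : ℝ) + 1) ^ (k - r)) atTop (𝓝 0) := by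
      have := (tendsto_one_div_add_atTop_nhds_zero_nat (𝕜 := ℝ)).pow (k - r)
      rw [zero_pow (by omega)] at this
      simpa using this
    have h3 := h1.mul h2
    rw [mul_zero] at h3
    refine h3.congr fun n => ?_
    rw [div_mul_div_comm, mul_one, ← pow_add, Nat.add_sub_cancel' h]

theorem tendsto_partitionCount {k : ℕ} (hk : 1 ≤ k) :
    Tendsto (fun n : ℕ => (partitionCount k n : ℝ) / ((n : ℝ) ^ ((k : ℝ) - 3 / 2) * 4 ^ n)) atTop
      (𝓝 (1 / (k.factorial : ℝ) * (1 / √π / 2 ^ (5 * k)))) := by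
  have hsum : Tendsto (fun n : ℕ => ∑ r ∈ Finset.range (k + 1),
      (((n + 1).choose r : ℝ) / ((n : ℝ) + 1) ^ k) *
      ∑ i ∈ Finset.range (4 * k + 1), biCoeff (crossedSeries ^ r) k i *
        (((n - r + (n - i)).choose (n - r) : ℝ) * √n / 4 ^ n)) atTop
      (𝓝 (∑ r ∈ Finset.range (k + 1), (if r = k then 1 / (k.factorial : ℝ) else 0) *
        ∑ i ∈ Finset.range (4 * k + 1), biCoeff (crossedSeries ^ r) k i *
          (1 / √π / 2 ^ (r + i)))) := by
    refine tendsto_finsetSum _ fun r hr => ?_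
    refine (tendsto_succ_choose_div_pow (by have := Finset.mem_range.1 hr; omega)).mul ?_
    exact tendsto_finsetSum _ fun i _ => (tendsto_choose_sub r i).const_mul _
  have hlim : (∑ r ∈ Finset.range (k + 1), (if r = k then 1 / (k.factorial : ℝ) else 0) *
        ∑ i ∈ Finset.range (4 * k + 1), biCoeff (crossedSeries ^ r) k i *
          (1 / √π / 2 ^ (r + i))) = 1 / (k.factorial : ℝ) * (1 / √π / 2 ^ (5 * k)) := by
    rw [Finset.sum_eq_single k]
    · rw [if_pos rfl, Finset.sum_eq_single (4 * k)]
      · rw [biCoeff_crossedSeries_pow_self, if_pos rfl, one_mul, show k + 4 * k = 5 * k by ring]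
      · intro i _ hi
        rw [biCoeff_crossedSeries_pow_self, if_neg hi, zero_mul]
      · intro h; simp at h
    · intro r _ hr
      rw [if_neg hr, zero_mul]
    · intro h; simp at h
  rw [hlim] at hsum
  -- Dividing by n + 1 leaves (n+1)^(k-1); this factor turns it into n^(k-1).
  have hone : Tendsto (fun n : ℕ => (((n : ℝ) + 1) / n) ^ (k - 1)) atTop (𝓝 1) := by
    have h := (tendsto_const_nhds (x := (1 : ℝ))).add
      (tendsto_const_div_atTop_nhds_zero_nat (1 : ℝ))
    rw [add_zero] at h
    have h' := h.pow (k - 1)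
    rw [one_pow] at h'
    refine h'.congr' ?_
    filter_upwards [eventually_gt_atTop 0] with n hn
    have hn' : (n : ℝ) ≠ 0 := by exact_mod_cast hn.ne'
    rw [add_div, div_self hn']
  have hprod := hsum.mul hone
  rw [mul_one] at hprod
  refine hprod.congr' ?_
  filter_upwards [eventually_gt_atTop (4 * k)] with n hn
  have hn' : (0 : ℝ) < n := by exact_mod_cast (Nat.zero_le _).trans_lt hn
  have e1 : (∑ r ∈ Finset.range (k + 1), (((n + 1).choose r : ℝ) / ((n : ℝ) + 1) ^ k) *
      ∑ i ∈ Finset.range (4 * k + 1), biCoeff (crossedSeries ^ r) k i *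
        (((n - r + (n - i)).choose (n - r) : ℝ) * √n / 4 ^ n)) =
      (((n : ℝ) + 1) * partitionCount k n) * (√n / (((n : ℝ) + 1) ^ k * 4 ^ n)) := by
    rw [succ_mul_partitionCount hn.le, Finset.sum_mul]
    refine Finset.sum_congr rfl fun r _ => ?_
    rw [mul_assoc, Finset.sum_mul, div_mul_eq_mul_div, mul_div_assoc, Finset.sum_div]
    congr 1
    refine Finset.sum_congr rfl fun i _ => ?_
    field_simp
  obtain ⟨j, rfl⟩ := Nat.exists_eq_add_of_le' hk
  have e2 : (n : ℝ) ^ (((j + 1 : ℕ) : ℝ) - 3 / 2) = n ^ j / √n := by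
    rw [show ((j + 1 : ℕ) : ℝ) - 3 / 2 = j - 1 / 2 by push_cast; ring, rpow_sub hn',
      rpow_natCast, sqrt_eq_rpow]
  have hsp : √(n : ℝ) ≠ 0 := (sqrt_pos.2 hn').ne'
  have hn1 : (n : ℝ) + 1 ≠ 0 := by positivity
  rw [e1, e2, Nat.add_sub_cancel, div_pow]
  field_simp
  ring

/-- With k = j + 1, Γ(j + 1/2) = (2j-1)!! √π / 2^j; the double factorials cancel, and 6k - 1 = j +
5k absorbs 2^j. -/
theorem doubleFactorial_div_Gamma {k : ℕ} (hk : 1 ≤ k) :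
    ((Nat.doubleFactorial (2 * k - 3) : ℕ) : ℝ) /
      ((2 : ℝ) ^ (6 * k - 1) * (Nat.factorial k : ℝ) * Real.Gamma ((k : ℝ) - 1 / 2)) =
      1 / (k.factorial : ℝ) * (1 / √π / 2 ^ (5 * k)) := by
  obtain ⟨j, rfl⟩ := Nat.exists_eq_add_of_le' hk
  rw [show ((j + 1 : ℕ) : ℝ) - 1 / 2 = j + 1 / 2 by push_cast; ring, Real.Gamma_nat_add_half,
    show 2 * (j + 1) - 3 = 2 * j - 1 by omega, show 6 * (j + 1) - 1 = j + 5 * (j + 1) by omega,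
    pow_add]
  have hpi : √π ≠ 0 := (sqrt_pos.2 pi_pos).ne'
  have hd : ((Nat.doubleFactorial (2 * j - 1) : ℕ) : ℝ) ≠ 0 := by
    exact_mod_cast (Nat.doubleFactorial_pos _).ne'
  field_simp

end Asymptotics

/-- For `k = 1` the truncated subtraction gives `0‼ = 1`, which agrees with `(-1)!! = 1`. -/
theorem mainTheorem4 (k : ℕ) (hk : 1 ≤ k) :
    Asymptotics.IsEquivalent Filter.atTop
      (fun n : ℕ => (partitionCount k n : ℝ))
      (fun n : ℕ =>
        ((Nat.doubleFactorial (2 * k - 3) : ℕ) : ℝ) /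
            ((2 : ℝ) ^ (6 * k - 1) * (Nat.factorial k : ℝ) * Real.Gamma ((k : ℝ) - 1 / 2)) *
          (n : ℝ) ^ ((k : ℝ) - 3 / 2) * (4 : ℝ) ^ n) := by
  rw [doubleFactorial_div_Gamma hk]
  have hc : (0 : ℝ) < 1 / (k.factorial : ℝ) * (1 / √Real.pi / 2 ^ (5 * k)) := by
    have := Real.sqrt_pos.2 Real.pi_pos
    have hf : (0 : ℝ) < k.factorial := by exact_mod_cast k.factorial_pos
    positivity
  have h := (tendsto_partitionCount hk).div_const (1 / (k.factorial : ℝ) * (1 / √Real.pi / 2 ^ (5 * k)))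
  rw [div_self hc.ne'] at h
  refine (Asymptotics.isEquivalent_iff_tendsto_one ?_).2 (h.congr fun n => ?_)
  · filter_upwards [Filter.eventually_gt_atTop 0] with n hn
    have hn' : (0 : ℝ) < n := by exact_mod_cast hn
    have := Real.rpow_pos_of_pos hn' ((k : ℝ) - 3 / 2)
    positivity
  · rw [Pi.div_apply, div_div, mul_assoc (1 / (k.factorial : ℝ) * _), mul_comm (_ * _ : ℝ) (_ * _)]
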